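/- **Setting.** Let $(M,g)$ be a smooth 4-dimensional space-time and let $U\subseteq M$ be an open set carrying a smooth orthonormal tetrad $(e_0,e_1,e_2,e_3)$, so that $g_{ab}=g(e_a,e_b)=\mathrm{diag}(-1,1,1,1)$. All components below are tetrad components and $u=e_0$ is the unit tangent field of a timelike congruence. The commutation coefficients $\gamma^c{}_{ab}$ are defined by $[e_a,e_b]=\gamma^c{}_{ab}e_c$. The Levi-Civita connection $\nabla_{e_b}e_a=\Gamma^c{}_{ab}e_c$ is given by $\Gamma_{cab}=\tfrac12(\gamma_{bca}+\gamma_{acb}-\gamma_{cab})$. Its curvature is $$\mathcal R^a{}_{bcd}=e_c(\Gamma^a{}_{bd})-e_d(\Gamma^a{}_{bc})+\Gamma^f{}_{bd}\Gamma^a{}_{fc}-\Gamma^f{}_{bc}\Gamma^a{}_{fd}-\gamma^f{}_{cd}\Gamma^a{}_{bf},$$ with Ricci tensor $\mathcal R_{bd}=\mathcal R^c{}_{bcd}$ and scalar curvature $\mathcal R=g^{bd}\mathcal R_{bd}$. Put $h_{ab}=g_{ab}+u_au_b$ and decompose $$u_{a;b}=-\dot u_au_b+\sigma_{ab}+\tfrac13\theta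 h_{ab}+\omega_{ab},\qquad \dot u_a=u_{a;b}u^b,\quad \theta=u^a{}_{;a},$$ where $\sigma_{ab}$ is symmetric and trace-free, $\omega_{ab}$ is antisymmetric, and both are orthogonal to $u$. Let $\eta_{abcd}$ be the totally antisymmetric tensor with $\eta_{0123}=-1$, and let $\varepsilon_{abc}=\eta_{abcd}u^d$. Let $E_{ab},H_{ab},T_{ab}$ be smooth symmetric tensor fields on $U$, with $E$ and $H$ trace-free and orthogonal to $u$. Define $R_{abcd}=R_{abcd}(E,H,T)$ by $$R_{abcd}=C_{abcd}+g_{a[c}S_{d]b}+g_{b[d}S_{c]a}-\tfrac13 S\,g_{a[c}g_{d]b},\qquad S_{ab}=T_{ab}-\tfrac12T^c{}_c\,g_{ab},\quad S=S^a{}_a,$$ $$C_{ab}{}^{cd}=4\big(u_{[a}u^{[c}+h_{[a}{}^{[c}\big)E_{b]}{}^{d]}+2\varepsilon_{abe}u^{[c}H^{d]e}+2\varepsilon^{cde}u_{[a}H_{b]e}.$$ The *Jacobi–Ricci–Bianchi (JRB) system* for $(e_a,\gamma,E,H,T)$ consists of * the Jacobi equations $e_{[a}\gamma^d{}_{bc]}-\gamma^d{}_{f[a}\gamma^f{}_{bc]}=0$,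 * the Ricci equations for $u$, $u^a{}_{;c;d}-u^a{}_{;d;c}=R^a{}_{bdc}u^b$, * the second Bianchi equations $R^a{}_{b[cd;e]}=0$, with $R=R(E,H,T)$. The Einstein field equations are $\mathcal R_{ab}-\tfrac12\mathcal R g_{ab}=T_{ab}$. **Theorem.** Suppose that at every point of $U$ the acceleration $\dot u$ is nonzero and is not an eigenvector of $\sigma^a{}_b+\omega^a{}_b$. Then the Einstein field equations are integrability conditions of the JRB system, in the following sense. 1. For all $E,H,T$ as above, the JRB system holds on $U$ if and only if the Einstein field equations hold on $U$ and $E_{ab}$, $H_{ab}$ are the electric and magnetic parts $C_{acbd}u^cu^d$ and $\tfrac12\eta_{ac}{}^{ef}C_{efbd}u^cu^d$ of the Weyl tensor $C_{abcd}$ of $\mathcal R_{abcd}$. In particular, every solution of the JRB system satisfies the Einstein field equations. 2. For all $E,H,T$ as above and every $x\in U$: if the JRB equations hold at $x$, and the first derivatives at $x$ of the Jacobi and Ricci equations also hold, then the Einstein field equations hold at $x$. 3. The curvature tensor $\mathcal R^a{}_{bcd}$ is the unique smooth tensor field $R^a{}_{bcd}$ on $U$ that has the symmetries $R_{abcd}=-R_{bacd}=-R_{abdc}=R_{cdab}$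 and satisfies the first Bianchi equations $R_{a[bcd]}=0$, the second Bianchi equations $R^a{}_{b[cd;e]}=0$, and the Ricci equations for $u$. -/

import Mathlib

open scoped Manifold ContDiff

noncomputable section

namespace JRB

/-! ### Tensor algebra in an orthonormal tetrad

Tetrad indices are elements of `Fin 4`, the index `0` being the timelike one.  An array
`Fin 4 → ⋯ → ℝ` holds the tetrad components of a tensor at one point. -/

/-- The constant tetrad components `g_ab = diag(-1, 1, 1, 1)` of the metric.  The array is its own
inverse, so it also gives `g^ab`. -/
def eta (a b : Fin 4) : ℝ := if a = b then (if a = 0 then -1 else 1) else 0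

/-- Contravariant components of `u = e_0`. -/
def uUp (a : Fin 4) : ℝ := if a = 0 then 1 else 0

/-- Covariant components `u_a = g_ab u^b`. -/
def uLow (a : Fin 4) : ℝ := ∑ b, eta a b * uUp b

/-- `h_ab = g_ab + u_a u_b`. -/
def hLow (a b : Fin 4) : ℝ := eta a b + uLow a * uLow b

/-- The mixed projector `h_a^b`. -/
def hMix (a b : Fin 4) : ℝ := ∑ c, eta b c * hLow a c

/-- The Levi-Civita tensor `η_abcd`, totally antisymmetric with `η_0123 = -1`. -/
def leviCivita (a b c d : Fin 4) : ℝ :=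
  -(((Matrix.of fun i j : Fin 4 => if ![a, b, c, d] i = j then (1 : ℤ) else 0).det : ℤ) : ℝ)

/-- `ε_abc = η_abcd u^d`. -/
def eps (a b c : Fin 4) : ℝ := ∑ d, leviCivita a b c d * uUp d

/-- Total antisymmetrization `F_[abc]`. -/
def alt3 (F : Fin 4 → Fin 4 → Fin 4 → ℝ) (a b c : Fin 4) : ℝ :=
  (1 / 6) * (F a b c + F b c a + F c a b - F b a c - F a c b - F c b a)

/-- Lowering the first index, `R_abcd = g_ae R^e_bcd`. -/
def lower (R : Fin 4 → Fin 4 → Fin 4 → Fin 4 → ℝ) (a b c d : Fin 4) : ℝ :=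
  ∑ e, eta a e * R e b c d

/-- Raising the first index, `R^a_bcd = g^ae R_ebcd`. -/
def raise (R : Fin 4 → Fin 4 → Fin 4 → Fin 4 → ℝ) (a b c d : Fin 4) : ℝ :=
  ∑ e, eta a e * R e b c d

/-- The trace `g^ab S_ab`. -/
def trace2 (S : Fin 4 → Fin 4 → ℝ) : ℝ := ∑ a, ∑ b, eta a b * S a b

/-- `R_bd = R^c_bcd`, for `R` with its first index up. -/
def ricci (R : Fin 4 → Fin 4 → Fin 4 → Fin 4 → ℝ) (b d : Fin 4) : ℝ := ∑ c, R c b c d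

/-- `g_a[c S_d]b + g_b[d S_c]a - (1/3) S g_a[c g_d]b`, where `S` also denotes the trace: for the
Ricci tensor `S` this is the Riemann tensor minus the Weyl tensor. -/
def ricciPart (S : Fin 4 → Fin 4 → ℝ) (a b c d : Fin 4) : ℝ :=
  (1 / 2) * (eta a c * S d b - eta a d * S c b) + (1 / 2) * (eta b d * S c a - eta b c * S d a)
    - (1 / 3) * trace2 S * ((1 / 2) * (eta a c * eta d b - eta a d * eta c b))

/-- The Weyl tensor `C_abcd` of a curvature tensor `R^a_bcd`. -/
def weyl (R : Fin 4 → Fin 4 → Fin 4 → Fin 4 → ℝ) (a b c d : Fin 4) : ℝ :=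
  lower R a b c d - ricciPart (ricci R) a b c d

/-- Electric part `C_acbd u^c u^d`. -/
def electric (C : Fin 4 → Fin 4 → Fin 4 → Fin 4 → ℝ) (a b : Fin 4) : ℝ :=
  ∑ c, ∑ d, C a c b d * uUp c * uUp d

/-- Magnetic part `(1/2) η_ac^ef C_efbd u^c u^d`. -/
def magnetic (C : Fin 4 → Fin 4 → Fin 4 → Fin 4 → ℝ) (a b : Fin 4) : ℝ :=
  (1 / 2) * ∑ c, ∑ d, ∑ e, ∑ f, ∑ m, ∑ n,
    leviCivita a c m n * eta m e * eta n f * C e f b d * uUp c * uUp d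

/-- The Weyl tensor built from `E` and `H`:
`C_abcd = 4 (u_[a u_[c + h_[a [c) E_b] d] + 2 ε_abe u_[c H_d]^e + 2 ε_cde u_[a H_b]^e`. -/
def weylOf (E H : Fin 4 → Fin 4 → ℝ) (a b c d : Fin 4) : ℝ :=
  (uLow a * uLow c + hLow a c) * E b d - (uLow b * uLow c + hLow b c) * E a d
    - (uLow a * uLow d + hLow a d) * E b c + (uLow b * uLow d + hLow b d) * E a c
    + (∑ e, ∑ f, eps a b e * eta e f * (uLow c * H d f - uLow d * H c f))
    + (∑ e, ∑ f, eps c d e * eta e f * (uLow a * H b f - uLow b * H a f))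

/-- The Ricci tensor that the field equations assign to `T`, namely `T_ab - (1/2) T g_ab`. -/
def ricciOf (T : Fin 4 → Fin 4 → ℝ) (a b : Fin 4) : ℝ := T a b - (1 / 2) * trace2 T * eta a b

/-- The tensor `R^a_bcd` built from `E`, `H` and `T`. -/
def riemannOf (E H T : Fin 4 → Fin 4 → ℝ) : Fin 4 → Fin 4 → Fin 4 → Fin 4 → ℝ :=
  raise fun a b c d => weylOf E H a b c d + ricciPart (ricciOf T) a b c d

/-- The Einstein field equations `R_ab - (1/2) R g_ab = T_ab` at a point, for the curvature tensor
`R^a_bcd`. -/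
def EinsteinEq (R : Fin 4 → Fin 4 → Fin 4 → Fin 4 → ℝ) (T : Fin 4 → Fin 4 → ℝ) : Prop :=
  ∀ a b, ricci R a b - (1 / 2) * trace2 (ricci R) * eta a b = T a b

/-! ### Tetrads and their Levi-Civita connection -/

variable {M : Type*} [TopologicalSpace M] [ChartedSpace (EuclideanSpace ℝ (Fin 4)) M]

/-- The functions `e_0, …, e_3` are smooth vector fields on `U` which are orthonormal for `g`, and
the `γ x c a b = γ^c_ab` are their (smooth) commutation coefficients,
`[e_a, e_b] = γ^c_ab e_c`. -/
structure IsTetrad [IsManifold (𝓡 4) ∞ M] (U : Set M)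
    (g : ∀ x : M, LinearMap.BilinForm ℝ (TangentSpace (𝓡 4) x))
    (e : Fin 4 → ∀ x : M, TangentSpace (𝓡 4) x)
    (γ : M → Fin 4 → Fin 4 → Fin 4 → ℝ) : Prop where
  smooth : ∀ a, ContMDiffOn (𝓡 4) (𝓡 4).tangent ∞
    (fun x => (⟨x, e a x⟩ : TangentBundle (𝓡 4) M)) U
  orthonormal : ∀ x ∈ U, ∀ a b, g x (e a x) (e b x) = eta a b
  smooth_comm : ∀ c a b, ContMDiffOn (𝓡 4) 𝓘(ℝ, ℝ) ∞ (fun x => γ x c a b) U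
  comm : ∀ x ∈ U, ∀ a b, VectorField.mlieBracket (𝓡 4) (e a) (e b) x = ∑ c, γ x c a b • e c x

/-- The directional derivative `e_a f`. -/
def dirD (e : Fin 4 → ∀ x : M, TangentSpace (𝓡 4) x) (a : Fin 4) (f : M → ℝ) (x : M) : ℝ :=
  mfderiv (𝓡 4) 𝓘(ℝ, ℝ) f x (e a x)

/-- The connection coefficients with all indices down,
`Γ_cab = (1/2) (γ_bca + γ_acb - γ_cab)`. -/
def connLow (γ : M → Fin 4 → Fin 4 → Fin 4 → ℝ) (x : M) (c a b : Fin 4) : ℝ :=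
  (1 / 2) * ∑ d, (eta b d * γ x d c a + eta a d * γ x d c b - eta c d * γ x d a b)

/-- The connection coefficients `Γ^c_ab` of the Levi-Civita connection,
`∇_{e_b} e_a = Γ^c_ab e_c`. -/
def conn (γ : M → Fin 4 → Fin 4 → Fin 4 → ℝ) (x : M) (c a b : Fin 4) : ℝ :=
  ∑ d, eta c d * connLow γ x d a b

/-- The curvature tensor `R^a_bcd` of the connection (second Cartan equations). -/
def curv (e : Fin 4 → ∀ x : M, TangentSpace (𝓡 4) x) (γ : M → Fin 4 → Fin 4 → Fin 4 → ℝ)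
    (x : M) (a b c d : Fin 4) : ℝ :=
  dirD e c (fun y => conn γ y a b d) x - dirD e d (fun y => conn γ y a b c) x
    + ∑ f, (conn γ x f b d * conn γ x a f c - conn γ x f b c * conn γ x a f d
      - γ x f c d * conn γ x a b f)

/-- `w^a_;c`. -/
def covD1 (e : Fin 4 → ∀ x : M, TangentSpace (𝓡 4) x) (γ : M → Fin 4 → Fin 4 → Fin 4 → ℝ)
    (w : M → Fin 4 → ℝ) (x : M) (a c : Fin 4) : ℝ :=
  dirD e c (fun y => w y a) x + ∑ f, conn γ x a f c * w x f

/-- `S^a_b;c`. -/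
def covD11 (e : Fin 4 → ∀ x : M, TangentSpace (𝓡 4) x) (γ : M → Fin 4 → Fin 4 → Fin 4 → ℝ)
    (S : M → Fin 4 → Fin 4 → ℝ) (x : M) (a b c : Fin 4) : ℝ :=
  dirD e c (fun y => S y a b) x + ∑ f, (conn γ x a f c * S x f b - conn γ x f b c * S x a f)

/-- `R^a_bcd;k`. -/
def covD13 (e : Fin 4 → ∀ x : M, TangentSpace (𝓡 4) x) (γ : M → Fin 4 → Fin 4 → Fin 4 → ℝ)
    (R : M → Fin 4 → Fin 4 → Fin 4 → Fin 4 → ℝ) (x : M) (a b c d k : Fin 4) : ℝ :=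
  dirD e k (fun y => R y a b c d) x
    + ∑ f, (conn γ x a f k * R x f b c d - conn γ x f b k * R x a f c d
      - conn γ x f c k * R x a b f d - conn γ x f d k * R x a b c f)

/-! ### Kinematics of the congruence `u = e_0` -/

/-- `u^a_;b`. -/
def gradU (e : Fin 4 → ∀ x : M, TangentSpace (𝓡 4) x) (γ : M → Fin 4 → Fin 4 → Fin 4 → ℝ)
    (x : M) (a b : Fin 4) : ℝ :=
  covD1 e γ (fun _ => uUp) x a b

/-- The acceleration, with its index up: `u^a_;b u^b`. -/
def accel (e : Fin 4 → ∀ x : M, TangentSpace (𝓡 4) x) (γ : M → Fin 4 → Fin 4 → Fin 4 → ℝ)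
    (x : M) (a : Fin 4) : ℝ :=
  ∑ b, gradU e γ x a b * uUp b

/-- The expansion scalar `θ = u^a_;a`. -/
def expansion (e : Fin 4 → ∀ x : M, TangentSpace (𝓡 4) x) (γ : M → Fin 4 → Fin 4 → Fin 4 → ℝ)
    (x : M) : ℝ :=
  ∑ a, gradU e γ x a a

/-- The projected gradient `h_a^c h_b^d u_c;d`. -/
def projGrad (e : Fin 4 → ∀ x : M, TangentSpace (𝓡 4) x) (γ : M → Fin 4 → Fin 4 → Fin 4 → ℝ)
    (x : M) (a b : Fin 4) : ℝ :=
  ∑ c, ∑ d, hMix a c * hMix b d * ∑ f, eta c f * gradU e γ x f d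

/-- The shear `σ_ab`. -/
def shear (e : Fin 4 → ∀ x : M, TangentSpace (𝓡 4) x) (γ : M → Fin 4 → Fin 4 → Fin 4 → ℝ)
    (x : M) (a b : Fin 4) : ℝ :=
  (1 / 2) * (projGrad e γ x a b + projGrad e γ x b a) - (1 / 3) * expansion e γ x * hLow a b

/-- The vorticity `ω_ab`. -/
def vorticity (e : Fin 4 → ∀ x : M, TangentSpace (𝓡 4) x) (γ : M → Fin 4 → Fin 4 → Fin 4 → ℝ)
    (x : M) (a b : Fin 4) : ℝ :=
  (1 / 2) * (projGrad e γ x a b - projGrad e γ x b a)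

/-- The endomorphism `σ^a_b + ω^a_b`. -/
def shearVorticity (e : Fin 4 → ∀ x : M, TangentSpace (𝓡 4) x)
    (γ : M → Fin 4 → Fin 4 → Fin 4 → ℝ) (x : M) : Matrix (Fin 4) (Fin 4) ℝ :=
  Matrix.of fun a b => ∑ c, eta a c * (shear e γ x c b + vorticity e γ x c b)

/-- The acceleration is nonzero at `x` and is not an eigenvector of `σ^a_b + ω^a_b`. -/
def Generic (e : Fin 4 → ∀ x : M, TangentSpace (𝓡 4) x) (γ : M → Fin 4 → Fin 4 → Fin 4 → ℝ)
    (x : M) : Prop :=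
  accel e γ x ≠ 0 ∧
    ¬ ∃ μ : ℝ, Module.End.HasEigenvector (Matrix.toLin' (shearVorticity e γ x)) μ (accel e γ x)

/-! ### The Jacobi, Ricci and Bianchi equations

Each family of equations is given by its residual, so that the equations read `residual = 0`. -/

/-- `e_[a γ^d_bc] - γ^d_f[a γ^f_bc]`. -/
def jacobiRes (e : Fin 4 → ∀ x : M, TangentSpace (𝓡 4) x) (γ : M → Fin 4 → Fin 4 → Fin 4 → ℝ)
    (d a b c : Fin 4) (x : M) : ℝ :=
  alt3 (fun a b c => dirD e a (fun y => γ y d b c) x - ∑ f, γ x d f a * γ x f b c) a b c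

/-- `u^a_;c;d - u^a_;d;c - R^a_bdc u^b`. -/
def ricciRes (e : Fin 4 → ∀ x : M, TangentSpace (𝓡 4) x) (γ : M → Fin 4 → Fin 4 → Fin 4 → ℝ)
    (R : M → Fin 4 → Fin 4 → Fin 4 → Fin 4 → ℝ) (a c d : Fin 4) (x : M) : ℝ :=
  covD11 e γ (gradU e γ) x a c d - covD11 e γ (gradU e γ) x a d c - ∑ b, R x a b d c * uUp b

/-- `R^a_b[cd;k]`. -/
def bianchiRes (e : Fin 4 → ∀ x : M, TangentSpace (𝓡 4) x) (γ : M → Fin 4 → Fin 4 → Fin 4 → ℝ)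
    (R : M → Fin 4 → Fin 4 → Fin 4 → Fin 4 → ℝ) (a b c d k : Fin 4) (x : M) : ℝ :=
  alt3 (fun c d k => covD13 e γ R x a b c d k) c d k

/-- The variables `E`, `H`, `T` of the extended formalism on `U`: smooth symmetric tensor fields,
`E` and `H` being also trace-free and orthogonal to `u`. -/
structure IsExtendedVars (U : Set M) (E H T : M → Fin 4 → Fin 4 → ℝ) : Prop where
  smooth_E : ∀ a b, ContMDiffOn (𝓡 4) 𝓘(ℝ, ℝ) ∞ (fun x => E x a b) U
  smooth_H : ∀ a b, ContMDiffOn (𝓡 4) 𝓘(ℝ, ℝ) ∞ (fun x => H x a b) U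
  smooth_T : ∀ a b, ContMDiffOn (𝓡 4) 𝓘(ℝ, ℝ) ∞ (fun x => T x a b) U
  symm_E : ∀ x ∈ U, ∀ a b, E x a b = E x b a
  symm_H : ∀ x ∈ U, ∀ a b, H x a b = H x b a
  symm_T : ∀ x ∈ U, ∀ a b, T x a b = T x b a
  trace_E : ∀ x ∈ U, trace2 (E x) = 0
  trace_H : ∀ x ∈ U, trace2 (H x) = 0
  orth_E : ∀ x ∈ U, ∀ a, ∑ b, E x a b * uUp b = 0
  orth_H : ∀ x ∈ U, ∀ a, ∑ b, H x a b * uUp b = 0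

/-- The Jacobi–Ricci–Bianchi system at the point `x`, for a tensor field `R^a_bcd`. -/
structure SystemAt (e : Fin 4 → ∀ x : M, TangentSpace (𝓡 4) x)
    (γ : M → Fin 4 → Fin 4 → Fin 4 → ℝ)
    (R : M → Fin 4 → Fin 4 → Fin 4 → Fin 4 → ℝ) (x : M) : Prop where
  jacobi : ∀ d a b c, jacobiRes e γ d a b c x = 0
  ricci : ∀ a c d, ricciRes e γ R a c d x = 0
  bianchi : ∀ a b c d k, bianchiRes e γ R a b c d k x = 0

/-- The system at the point `x` together with the first derivatives at `x` of its Jacobi and Ricci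
equations. -/
structure ProlongedSystemAt (e : Fin 4 → ∀ x : M, TangentSpace (𝓡 4) x)
    (γ : M → Fin 4 → Fin 4 → Fin 4 → ℝ)
    (R : M → Fin 4 → Fin 4 → Fin 4 → Fin 4 → ℝ) (x : M) : Prop
    extends SystemAt e γ R x where
  deriv_jacobi : ∀ k d a b c, dirD e k (jacobiRes e γ d a b c) x = 0
  deriv_ricci : ∀ k a c d, dirD e k (ricciRes e γ R a c d) x = 0

/-- A smooth tensor field `R^a_bcd` on `U` with the symmetries of a Riemann tensor which satisfies
the first and second Bianchi equations and the Ricci equations for `u`. -/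
structure IsCurvatureLike (U : Set M) (e : Fin 4 → ∀ x : M, TangentSpace (𝓡 4) x)
    (γ : M → Fin 4 → Fin 4 → Fin 4 → ℝ)
    (R : M → Fin 4 → Fin 4 → Fin 4 → Fin 4 → ℝ) : Prop where
  smooth : ∀ a b c d, ContMDiffOn (𝓡 4) 𝓘(ℝ, ℝ) ∞ (fun x => R x a b c d) U
  antisymm_left : ∀ x ∈ U, ∀ a b c d, lower (R x) a b c d = -lower (R x) b a c d
  antisymm_right : ∀ x ∈ U, ∀ a b c d, lower (R x) a b c d = -lower (R x) a b d c
  symm_pair : ∀ x ∈ U, ∀ a b c d, lower (R x) a b c d = lower (R x) c d a b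
  bianchi_first : ∀ x ∈ U, ∀ a b c d, alt3 (fun b c d => lower (R x) a b c d) b c d = 0
  bianchi_second : ∀ x ∈ U, ∀ a b c d k, bianchiRes e γ R a b c d k x = 0
  ricci : ∀ x ∈ U, ∀ a c d, ricciRes e γ R a c d x = 0

end JRB

end

/-!
The curvature `𝓡` of the tetrad solves every equation of the system, so the difference `D` of `𝓡`
and a solution `R` is a form on bivectors that satisfies the homogeneous equations. The Ricci
equations say that `D^a_bcd u^b` vanishes, to first order by hypothesis, so that in
`D^a_b[cd;k] u^b = 0` only the algebraic terms `u^f_;[k D^a_|f|cd]` survive. What is left of `D` is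
a symmetric spatial form `P`, and these terms say that `v × P = 0` for the acceleration `v`, so
that `P = c v ⊗ v`, and that `A P` is symmetric for the spatial gradient `A` of `u`. If `c ≠ 0`,
the latter forces `A v ∥ v`, which genericity excludes. Hence `R = 𝓡`, and the field equations
express that the trace part of `R`, built from `T`, is that of `𝓡`.
-/

namespace JRB

open VectorField Filter Topology

section LieBracket

instance (n : ℕ∞ω) [ENat.LEInfty n] : ENat.LEInfty (minSmoothness ℝ n) :=
  ⟨by simpa only [minSmoothness_of_isRCLikeNormedField] using ENat.LEInfty.out⟩

variable {E H M : Type*} [NormedAddCommGroup E] [NormedSpace ℝ E] [TopologicalSpace H]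
  {I : ModelWithCorners ℝ E H} [TopologicalSpace M] [ChartedSpace H M] [IsManifold I ∞ M]
  {U : Set M} {x : M}

lemma contMDiffOn_mvfderiv_apply {V : ∀ x : M, TangentSpace I x} {f : M → ℝ}
    (hU : IsOpen U) (hV : CMDiff[U] ∞ (T% V)) (hf : CMDiff[U] ∞ f) :
    CMDiff[U] ∞ fun y => d% f y (V y) := by
  have hT : ContMDiffOn I 𝓘(ℝ, ℝ).tangent ∞
      (fun y => tangentMapWithin I 𝓘(ℝ, ℝ) f U ⟨y, V y⟩) U :=
    (hf.contMDiffOn_tangentMapWithin (by simp) hU.uniqueMDiffOn).comp hV fun y hy => hy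
  have hsnd : ContMDiffOn I 𝓘(ℝ, ℝ) ∞
      (fun y => (tangentMapWithin I 𝓘(ℝ, ℝ) f U ⟨y, V y⟩).2) U := fun y hy => by
    simpa using! (Bundle.contMDiffWithinAt_totalSpace.1 (hT y hy)).2
  refine hsnd.congr fun y hy => ?_
  simp only [tangentMapWithin, mfderivWithin_of_isOpen hU hy]
  rfl

variable [CompleteSpace E] {V W Z : ∀ x : M, TangentSpace I x}

lemma mdifferentiableAt_mlieBracket (hV : CMDiffAt ∞ (T% V) x) (hW : CMDiffAt ∞ (T% W) x) :
    MDiffAt (T% (mlieBracket I V W)) x := by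
  have : IsManifold I (∞ + 1) M := by simpa
  exact (hV.mlieBracket_vectorField (n := ⊤) (m := ⊤) hW (by simp)).mdifferentiableAt (by simp)

lemma leibniz_mlieBracket_of_infty (hV : CMDiffAt ∞ (T% V) x) (hW : CMDiffAt ∞ (T% W) x)
    (hZ : CMDiffAt ∞ (T% Z) x) :
    mlieBracket I V (mlieBracket I W Z) x
      = mlieBracket I (mlieBracket I V W) Z x + mlieBracket I W (mlieBracket I V Z) x :=
  leibniz_identity_mlieBracket_apply (hV.of_le ENat.LEInfty.out) (hW.of_le ENat.LEInfty.out)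
    (hZ.of_le ENat.LEInfty.out)

lemma mlieBracket_cyclic_sum (hV : CMDiffAt ∞ (T% V) x) (hW : CMDiffAt ∞ (T% W) x)
    (hZ : CMDiffAt ∞ (T% Z) x) :
    mlieBracket I V (mlieBracket I W Z) x + mlieBracket I W (mlieBracket I Z V) x
      + mlieBracket I Z (mlieBracket I V W) x = 0 := by
  have hswap : mlieBracket I W (mlieBracket I V Z) x = -mlieBracket I W (mlieBracket I Z V) x := by
    rw [mlieBracket_swap (V := V), ← neg_one_smul ℝ,
      mlieBracket_const_smul_right (mdifferentiableAt_mlieBracket hZ hV), neg_one_smul]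
  rw [leibniz_mlieBracket_of_infty hV hW hZ, mlieBracket_swap_apply (V := mlieBracket I V W),
    hswap]
  abel

lemma mlieBracket_sum_right {ι : Type*} {s : Finset ι} {F : ι → ∀ x : M, TangentSpace I x}
    (hF : ∀ i ∈ s, MDiffAt (T% (F i)) x) :
    mlieBracket I V (fun y => ∑ i ∈ s, F i y) x = ∑ i ∈ s, mlieBracket I V (F i) x := by
  classical
  induction s using Finset.induction_on with
  | empty => exact congrFun (mlieBracket_zero_right (I := I) (W := V)) x
  | insert i s hi ih =>
    have hs : ∀ j ∈ s, MDiffAt (T% (F j)) x := fun j hj => hF j (Finset.mem_insert_of_mem hj)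
    simp only [Finset.sum_insert hi, ← ih hs]
    exact mlieBracket_add_right (hF i (Finset.mem_insert_self i s)) (.sum_section hs)

lemma mlieBracket_mlieBracket_smul {f : M → ℝ} (hU : IsOpen U) (hx : x ∈ U)
    (hW : CMDiff[U] ∞ (T% W)) (hZ : CMDiff[U] ∞ (T% Z)) (hf : CMDiff[U] ∞ f) :
    mlieBracket I V (mlieBracket I W (f • Z)) x
      = d% (fun y => d% f y (W y)) x (V x) • Z x + d% f x (W x) • mlieBracket I V Z x
        + (d% f x (V x) • mlieBracket I W Z x
          + f x • mlieBracket I V (mlieBracket I W Z) x) := by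
  have hfd {y : M} (hy : y ∈ U) : MDiffAt f y :=
    (hf.contMDiffAt (hU.mem_nhds hy)).mdifferentiableAt (by simp)
  have hZd {y : M} (hy : y ∈ U) : MDiffAt (T% Z) y :=
    (hZ.contMDiffAt (hU.mem_nhds hy)).mdifferentiableAt (by simp)
  have hWf : MDiffAt (fun y => d% f y (W y)) x :=
    ((contMDiffOn_mvfderiv_apply hU hW hf).contMDiffAt (hU.mem_nhds hx)).mdifferentiableAt
      (by simp)
  have hWZ : MDiffAt (T% (mlieBracket I W Z)) x :=
    mdifferentiableAt_mlieBracket (hW.contMDiffAt (hU.mem_nhds hx))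
      (hZ.contMDiffAt (hU.mem_nhds hx))
  have hfZ : mlieBracket I W (f • Z)
      =ᶠ[𝓝 x] (fun y => d% f y (W y)) • Z + f • mlieBracket I W Z := by
    filter_upwards [hU.mem_nhds hx] with y hy using mlieBracket_smul_right (hfd hy) (hZd hy)
  rw [EventuallyEq.rfl.mlieBracket_vectorField_eq hfZ,
    mlieBracket_add_right (hWf.smul_section (hZd hx)) ((hfd hx).smul_section hWZ),
    mlieBracket_smul_right hWf (hZd hx), mlieBracket_smul_right (hfd hx) hWZ]

/- Both sides are the coefficient of `Z` in the Leibniz identity for `V`, `W` and `f • Z`. -/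
lemma mvfderiv_mlieBracket_smul {f : M → ℝ} (hU : IsOpen U) (hx : x ∈ U)
    (hV : CMDiff[U] ∞ (T% V)) (hW : CMDiff[U] ∞ (T% W)) (hZ : CMDiff[U] ∞ (T% Z))
    (hf : CMDiff[U] ∞ f) :
    d% f x (mlieBracket I V W x) • Z x
      = (d% (fun y => d% f y (W y)) x (V x) - d% (fun y => d% f y (V y)) x (W x)) • Z x := by
  have hVx := hV.contMDiffAt (hU.mem_nhds hx)
  have hWx := hW.contMDiffAt (hU.mem_nhds hx)
  have hZx := hZ.contMDiffAt (hU.mem_nhds hx)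
  have hfx := hf.contMDiffAt (hU.mem_nhds hx)
  have hleibniz : mlieBracket I V (mlieBracket I W (f • Z)) x
      = mlieBracket I (mlieBracket I V W) (f • Z) x
        + mlieBracket I W (mlieBracket I V (f • Z)) x :=
    leibniz_mlieBracket_of_infty hVx hWx (hfx.smul_section hZx)
  rw [mlieBracket_mlieBracket_smul hU hx hW hZ hf, mlieBracket_mlieBracket_smul hU hx hV hZ hf,
    mlieBracket_smul_right (hfx.mdifferentiableAt (by simp)) (hZx.mdifferentiableAt (by simp)),
    leibniz_mlieBracket_of_infty hVx hWx hZx] at hleibniz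
  rw [← sub_eq_zero, ← sub_eq_zero.2 hleibniz.symm]
  module

lemma mvfderiv_mlieBracket {f : M → ℝ} (hU : IsOpen U) (hx : x ∈ U)
    (hV : CMDiff[U] ∞ (T% V)) (hW : CMDiff[U] ∞ (T% W)) (hf : CMDiff[U] ∞ f) :
    d% f x (mlieBracket I V W x)
      = d% (fun y => d% f y (W y)) x (V x) - d% (fun y => d% f y (V y)) x (W x) := by
  by_cases hzero : ∀ z : TangentSpace I x, z = 0
  · rw [hzero (mlieBracket I V W x), hzero (V x), hzero (W x)]
    simp only [map_zero, sub_zero]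
  push Not at hzero
  obtain ⟨z, hz⟩ := hzero
  obtain ⟨s, hs, hZ⟩ := FiberBundle.exists_contMDiffOn_extend (k := ∞) I E z
  have hs' : interior s ∩ U ⊆ U := Set.inter_subset_right
  have hsmul := mvfderiv_mlieBracket_smul (isOpen_interior.inter hU)
    ⟨mem_interior_iff_mem_nhds.2 hs, hx⟩ (hV.mono hs') (hW.mono hs')
    (hZ.mono (Set.inter_subset_left.trans interior_subset)) (hf.mono hs')
  rw [FiberBundle.extend_apply_self] at hsmul
  exact smul_left_injective ℝ hz hsmul

end LieBracket

section DirectionalDerivative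

variable {M : Type*} [TopologicalSpace M] [ChartedSpace (EuclideanSpace ℝ (Fin 4)) M]
  {e : Fin 4 → ∀ x : M, TangentSpace (𝓡 4) x} {a : Fin 4} {f h : M → ℝ} {f' h' : ℝ} {x : M}

/-- `f` is differentiable at `x` and `e_a f = f'` there. Pairing the value with differentiability
lets the derivative of a compound expression be assembled from those of its parts. -/
def HasDirD (e : Fin 4 → ∀ x : M, TangentSpace (𝓡 4) x) (a : Fin 4) (f : M → ℝ) (f' : ℝ)
    (x : M) : Prop :=
  MDifferentiableAt (𝓡 4) 𝓘(ℝ, ℝ) f x ∧ dirD e a f x = f'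

lemma dirD_eq_mvfderiv (e : Fin 4 → ∀ x : M, TangentSpace (𝓡 4) x) (a : Fin 4) (f : M → ℝ) :
    dirD e a f = fun y => mvfderiv (𝓡 4) f y (e a y) := rfl

lemma hasDirD_const (c : ℝ) : HasDirD e a (fun _ => c) 0 x :=
  ⟨mdifferentiableAt_const, by simp only [dirD_eq_mvfderiv, mvfderiv_const]; rfl⟩

namespace HasDirD

lemma add (hf : HasDirD e a f f' x) (hh : HasDirD e a h h' x) :
    HasDirD e a (fun y => f y + h y) (f' + h') x :=
  ⟨hf.1.add hh.1, by
    rw [← hf.2, ← hh.2]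
    simp only [dirD_eq_mvfderiv, mvfderiv_fun_add hf.1 hh.1]
    rfl⟩

lemma sub (hf : HasDirD e a f f' x) (hh : HasDirD e a h h' x) :
    HasDirD e a (fun y => f y - h y) (f' - h') x :=
  ⟨hf.1.sub hh.1, by
    rw [← hf.2, ← hh.2]
    simp only [dirD_eq_mvfderiv, mvfderiv_fun_sub hf.1 hh.1]
    rfl⟩

lemma mul (hf : HasDirD e a f f' x) (hh : HasDirD e a h h' x) :
    HasDirD e a (fun y => f y * h y) (f' * h x + f x * h') x :=
  ⟨hf.1.mul hh.1, by
    rw [← hf.2, ← hh.2, add_comm, mul_comm (dirD e a f x)]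
    simp only [dirD_eq_mvfderiv, mvfderiv_fun_mul hf.1 hh.1]
    rfl⟩

lemma const_mul (c : ℝ) (hf : HasDirD e a f f' x) :
    HasDirD e a (fun y => c * f y) (c * f') x := by
  simpa only [zero_mul, zero_add] using (hasDirD_const c).mul hf

lemma neg (hf : HasDirD e a f f' x) : HasDirD e a (fun y => -f y) (-f') x := by
  simpa only [neg_one_mul] using hf.const_mul (-1)

lemma sum {ι : Type*} {s : Finset ι} {F : ι → M → ℝ} {F' : ι → ℝ}
    (hF : ∀ i ∈ s, HasDirD e a (F i) (F' i) x) :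
    HasDirD e a (fun y => ∑ i ∈ s, F i y) (∑ i ∈ s, F' i) x := by
  classical
  induction s using Finset.induction_on with
  | empty => simpa only [Finset.sum_empty] using hasDirD_const 0
  | insert i s hi ih =>
    simpa only [Finset.sum_insert hi] using (hF i (Finset.mem_insert_self i s)).add
      (ih fun j hj => hF j (Finset.mem_insert_of_mem hj))

end HasDirD

lemma dirD_congr_of_eqOn {U : Set M} (hU : IsOpen U) (hx : x ∈ U) (hfh : ∀ y ∈ U, f y = h y) :
    dirD e a f x = dirD e a h x := by
  simp only [dirD, (show f =ᶠ[𝓝 x] h from mem_of_superset (hU.mem_nhds hx) hfh).mfderiv_eq]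
  rfl

lemma hasDirD_of_contMDiffOn {U : Set M} (hU : IsOpen U) (hx : x ∈ U)
    (hf : ContMDiffOn (𝓡 4) 𝓘(ℝ, ℝ) ∞ f U) : HasDirD e a f (dirD e a f x) x :=
  ⟨(hf.contMDiffAt (hU.mem_nhds hx)).mdifferentiableAt (by simp), rfl⟩

end DirectionalDerivative

section SecondBianchi

/- With `D_k = e_k + ad A_k` and `R_cd = [D_c, D_d] - G^f_cd D_f`, this is the Jacobi identity for
the operators `D_k`. -/
lemma bianchi_second_of_jacobi {ι 𝕜 L : Type*} [Fintype ι] [CommRing 𝕜] [LieRing L]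
    [LieAlgebra 𝕜 L] {A : ι → L} {dA : ι → ι → L} {ddA : ι → ι → ι → L} {G : ι → ι → ι → 𝕜}
    {dG : ι → ι → ι → ι → 𝕜} {R : ι → ι → L} {dR : ι → ι → ι → L}
    (hG : ∀ f a b, G f a b = -G f b a)
    (hcomm : ∀ a b c, ddA a b c - ddA b a c = ∑ f, G f a b • dA f c)
    (hjac : ∀ f a b c, (dG a f b c - ∑ h, G f h a * G h b c)
      + (dG b f c a - ∑ h, G f h b * G h c a) + (dG c f a b - ∑ h, G f h c * G h a b) = 0)
    (hR : ∀ a b, R a b = dA a b - dA b a + ⁅A a, A b⁆ - ∑ f, G f a b • A f)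
    (hdR : ∀ a b c, dR a b c = ddA a b c - ddA a c b + (⁅dA a b, A c⁆ + ⁅A b, dA a c⁆)
      - ∑ f, (dG a f b c • A f + G f b c • dA a f)) (a b c : ι) :
    (dR a b c + ⁅A a, R b c⁆ + ∑ f, G f b c • R a f)
      + (dR b c a + ⁅A b, R c a⁆ + ∑ f, G f c a • R b f)
      + (dR c a b + ⁅A c, R a b⁆ + ∑ f, G f a b • R c f) = 0 := by
  have hexpand (a b c : ι) : dR a b c + ⁅A a, R b c⁆ + ∑ f, G f b c • R a f
      = (ddA a b c - ddA a c b - ∑ f, G f b c • dA f a)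
        + (⁅dA a b, A c⁆ + ⁅A b, dA a c⁆ - ⁅dA b c, A a⁆ - ⁅A a, dA c b⁆) + ⁅A a, ⁅A b, A c⁆⁆
        - ∑ f, (dG a f b c - ∑ h, G f h a * G h b c) • A f := by
    have hquad : ∑ f, G f b c • ∑ h, G h a f • A h
        = -∑ f, (∑ h, G f h a * G h b c) • A f := by
      simp only [Finset.smul_sum, Finset.sum_smul, smul_smul, ← Finset.sum_neg_distrib]
      rw [Finset.sum_comm]
      refine Finset.sum_congr rfl fun f _ => Finset.sum_congr rfl fun h _ => ?_
      rw [hG f a h, ← neg_smul]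
      ring_nf
    simp only [hR, hdR, lie_sub, lie_add, lie_sum, lie_smul, smul_sub, smul_add, sub_smul,
      Finset.sum_sub_distrib, Finset.sum_add_distrib, hquad, ← lie_skew (A a) (dA b c)]
    abel
  rw [hexpand, hexpand, hexpand]
  have hj : ∑ f, (dG a f b c - ∑ h, G f h a * G h b c) • A f
      + ∑ f, (dG b f c a - ∑ h, G f h b * G h c a) • A f
      + ∑ f, (dG c f a b - ∑ h, G f h c * G h a b) • A f = 0 := by
    simp only [← Finset.sum_add_distrib, ← add_smul, hjac, zero_smul, Finset.sum_const_zero]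
  rw [← hcomm, ← hcomm, ← hcomm]
  linear_combination (norm := abel) lie_jacobi (A a) (A b) (A c) - hj

end SecondBianchi

section Tetrad

lemma sum_eta_mul (a : Fin 4) (t : Fin 4 → ℝ) : ∑ b, eta a b * t b = eta a a * t a := by
  simp [eta]

lemma eta_mul_self (a : Fin 4) : eta a a * eta a a = 1 := by
  simp only [eta, if_true]
  split_ifs <;> norm_num

lemma lower_eq (R : Fin 4 → Fin 4 → Fin 4 → Fin 4 → ℝ) (a b c d : Fin 4) :
    lower R a b c d = eta a a * R a b c d := sum_eta_mul a fun e => R e b c d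

lemma conn_eq {M : Type*} (γ : M → Fin 4 → Fin 4 → Fin 4 → ℝ) (x : M) (c a b : Fin 4) :
    conn γ x c a b = eta c c * ((1 / 2) * (eta b b * γ x b c a + eta a a * γ x a c b
      - eta c c * γ x c a b)) := by
  simp only [conn, connLow, sum_eta_mul, Finset.sum_add_distrib, Finset.sum_sub_distrib]

lemma alt3_eq_zero_of_cyclic_sum {F : Fin 4 → Fin 4 → Fin 4 → ℝ}
    (hF : ∀ a b c, F a b c + F b c a + F c a b = 0) (a b c : Fin 4) : alt3 F a b c = 0 := by
  rw [alt3]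
  linear_combination (1 / 6) * (hF a b c - hF b a c)

lemma pair_symm_of_cyclic_sum {ι : Type*} {R : ι → ι → ι → ι → ℝ}
    (hl : ∀ a b c d, R a b c d = -R b a c d) (hr : ∀ a b c d, R a b c d = -R a b d c)
    (hc : ∀ a b c d, R a b c d + R a c d b + R a d b c = 0) (a b c d : ι) :
    R a b c d = R c d a b := by
  linarith [hc a b c d, hc b c d a, hc c d a b, hc d a b c, hl b a c d, hl d c a b, hl c a b d,
    hr a c b d, hl d a b c, hl c b d a, hl d b c a, hr b d c a]

variable {M : Type*} [TopologicalSpace M] [ChartedSpace (EuclideanSpace ℝ (Fin 4)) M]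
  {e : Fin 4 → ∀ x : M, TangentSpace (𝓡 4) x} {γ : M → Fin 4 → Fin 4 → Fin 4 → ℝ} {x : M}

/-- The entrywise derivative `e_k A` of a matrix of functions. -/
noncomputable def dirDMatrix (e : Fin 4 → ∀ x : M, TangentSpace (𝓡 4) x) (k : Fin 4)
    (A : M → Matrix (Fin 4) (Fin 4) ℝ) (x : M) : Matrix (Fin 4) (Fin 4) ℝ :=
  .of fun a b => dirD e k (fun y => A y a b) x

/-- The matrix `(Γ^a_bc)_ab` of the connection one-forms evaluated on `e_c`. -/
noncomputable def connMatrix (γ : M → Fin 4 → Fin 4 → Fin 4 → ℝ) (c : Fin 4) (x : M) :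
    Matrix (Fin 4) (Fin 4) ℝ :=
  .of fun a b => conn γ x a b c

/-- The matrix `(R^a_bcd)_ab` of the curvature two-forms evaluated on `e_c` and `e_d`. -/
noncomputable def curvMatrix (e : Fin 4 → ∀ x : M, TangentSpace (𝓡 4) x)
    (γ : M → Fin 4 → Fin 4 → Fin 4 → ℝ) (c d : Fin 4) (x : M) : Matrix (Fin 4) (Fin 4) ℝ :=
  .of fun a b => curv e γ x a b c d

lemma curvMatrix_eq (c d : Fin 4) :
    curvMatrix e γ c d x = dirDMatrix e c (connMatrix γ d) x - dirDMatrix e d (connMatrix γ c) x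
      + ⁅connMatrix γ c x, connMatrix γ d x⁆ - ∑ f, γ x f c d • connMatrix γ f x := by
  ext a b
  simp only [curvMatrix, curv, dirDMatrix, connMatrix, Ring.lie_def, Matrix.of_apply,
    Matrix.add_apply, Matrix.sub_apply, Matrix.mul_apply, Matrix.sum_apply, Matrix.smul_apply,
    smul_eq_mul, Finset.sum_sub_distrib, mul_comm (conn γ x a _ _), add_sub_assoc]

variable [IsManifold (𝓡 4) ∞ M] {U : Set M}
  {g : ∀ x : M, LinearMap.BilinForm ℝ (TangentSpace (𝓡 4) x)}

namespace IsTetrad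

lemma contMDiffAt (he : IsTetrad U g e γ) (hU : IsOpen U) (hx : x ∈ U) (a : Fin 4) :
    ContMDiffAt (𝓡 4) (𝓡 4).tangent ∞ (fun y => (⟨y, e a y⟩ : TangentBundle (𝓡 4) M)) x :=
  (he.smooth a).contMDiffAt (hU.mem_nhds hx)

lemma contMDiffOn_dirD (he : IsTetrad U g e γ) (hU : IsOpen U) {f : M → ℝ}
    (hf : ContMDiffOn (𝓡 4) 𝓘(ℝ, ℝ) ∞ f U) (a : Fin 4) :
    ContMDiffOn (𝓡 4) 𝓘(ℝ, ℝ) ∞ (dirD e a f) U :=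
  contMDiffOn_mvfderiv_apply hU (he.smooth a) hf

lemma eq_zero_of_sum_smul_eq_zero (he : IsTetrad U g e γ) (hx : x ∈ U) {t : Fin 4 → ℝ}
    (ht : ∑ c, t c • e c x = 0) (d : Fin 4) : t d = 0 := by
  have h := congrArg (fun v => g x v (e d x)) ht
  simp only [map_sum, map_smul, LinearMap.sum_apply, LinearMap.smul_apply, map_zero,
    LinearMap.zero_apply, he.orthonormal x hx, smul_eq_mul, eta, mul_ite, mul_zero,
    Finset.sum_ite_eq', Finset.mem_univ, if_true] at h
  split_ifs at h <;> linarith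

lemma comm_antisymm (he : IsTetrad U g e γ) (hx : x ∈ U) (c a b : Fin 4) :
    γ x c a b = -γ x c b a := by
  have h : ∑ c, (γ x c a b + γ x c b a) • e c x = 0 := by
    simp only [add_smul, Finset.sum_add_distrib, ← he.comm x hx]
    rw [mlieBracket_swap_apply, neg_add_cancel]
  linarith [he.eq_zero_of_sum_smul_eq_zero hx h c]

lemma dirD_dirD_sub (he : IsTetrad U g e γ) (hU : IsOpen U) (hx : x ∈ U) {f : M → ℝ}
    (hf : ContMDiffOn (𝓡 4) 𝓘(ℝ, ℝ) ∞ f U) (a b : Fin 4) :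
    dirD e a (dirD e b f) x - dirD e b (dirD e a f) x = ∑ c, γ x c a b * dirD e c f x := by
  simp only [dirD_eq_mvfderiv]
  rw [← mvfderiv_mlieBracket hU hx (he.smooth a) (he.smooth b) hf, he.comm x hx]
  simp only [map_sum, map_smul, smul_eq_mul]

lemma mlieBracket_sum_smul (he : IsTetrad U g e γ) (hU : IsOpen U) (hx : x ∈ U)
    {t : Fin 4 → M → ℝ} (ht : ∀ c, ContMDiffOn (𝓡 4) 𝓘(ℝ, ℝ) ∞ (t c) U) (a : Fin 4) :
    mlieBracket (𝓡 4) (e a) (fun y => ∑ c, t c y • e c y) x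
      = ∑ c, (dirD e a (t c) x + ∑ f, γ x c a f * t f x) • e c x := by
  have he' (c : Fin 4) := (he.contMDiffAt hU hx c).mdifferentiableAt (by simp)
  have ht' (c : Fin 4) := ((ht c).contMDiffAt (hU.mem_nhds hx)).mdifferentiableAt (by simp)
  have hsmul (c : Fin 4) : mlieBracket (𝓡 4) (e a) (t c • e c) x
      = dirD e a (t c) x • e c x + t c x • ∑ f, γ x f a c • e f x := by
    rw [← he.comm x hx]
    exact mlieBracket_smul_right (ht' c) (he' c)
  refine (mlieBracket_sum_right fun c _ => (ht' c).smul_section (he' c)).trans ?_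
  simp only [hsmul, add_smul, Finset.sum_add_distrib, Finset.smul_sum, Finset.sum_smul, smul_smul]
  rw [Finset.sum_comm]
  simp only [mul_comm]

lemma mlieBracket_mlieBracket (he : IsTetrad U g e γ) (hU : IsOpen U) (hx : x ∈ U)
    (a b c : Fin 4) :
    mlieBracket (𝓡 4) (e a) (mlieBracket (𝓡 4) (e b) (e c)) x
      = ∑ d, (dirD e a (fun y => γ y d b c) x - ∑ f, γ x d f a * γ x f b c) • e d x := by
  have hcomm : mlieBracket (𝓡 4) (e b) (e c) =ᶠ[𝓝 x] fun y => ∑ d, γ y d b c • e d y := by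
    filter_upwards [hU.mem_nhds hx] with y hy using he.comm y hy b c
  refine (EventuallyEq.rfl.mlieBracket_vectorField_eq hcomm).trans
    ((he.mlieBracket_sum_smul hU hx (fun d => he.smooth_comm d b c) a).trans ?_)
  simp only [he.comm_antisymm hx _ a, neg_mul, Finset.sum_neg_distrib, sub_eq_add_neg]

lemma jacobi (he : IsTetrad U g e γ) (hU : IsOpen U) (hx : x ∈ U) (d a b c : Fin 4) :
    (dirD e a (fun y => γ y d b c) x - ∑ f, γ x d f a * γ x f b c)
      + (dirD e b (fun y => γ y d c a) x - ∑ f, γ x d f b * γ x f c a)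
      + (dirD e c (fun y => γ y d a b) x - ∑ f, γ x d f c * γ x f a b) = 0 := by
  have hcyclic := mlieBracket_cyclic_sum (he.contMDiffAt hU hx a) (he.contMDiffAt hU hx b)
    (he.contMDiffAt hU hx c)
  simp only [he.mlieBracket_mlieBracket hU hx, ← Finset.sum_add_distrib, ← add_smul] at hcyclic
  exact he.eq_zero_of_sum_smul_eq_zero hx hcyclic d

lemma jacobiRes_eq_zero (he : IsTetrad U g e γ) (hU : IsOpen U) (hx : x ∈ U)
    (d a b c : Fin 4) : jacobiRes e γ d a b c x = 0 :=
  alt3_eq_zero_of_cyclic_sum (he.jacobi hU hx d) a b c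

lemma contMDiffOn_conn (he : IsTetrad U g e γ) (c a b : Fin 4) :
    ContMDiffOn (𝓡 4) 𝓘(ℝ, ℝ) ∞ (fun x => conn γ x c a b) U := by
  simp only [conn_eq]
  have hγ := he.smooth_comm
  exact contMDiffOn_const.mul (contMDiffOn_const.mul (((contMDiffOn_const.mul (hγ b c a)).add
    (contMDiffOn_const.mul (hγ a c b))).sub (contMDiffOn_const.mul (hγ c a b))))

lemma comm_eq_conn_sub_conn (he : IsTetrad U g e γ) (hx : x ∈ U) (c a b : Fin 4) :
    γ x c a b = conn γ x c b a - conn γ x c a b := by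
  rw [conn_eq, conn_eq, he.comm_antisymm hx c b a]
  linear_combination -γ x c a b * eta_mul_self c

lemma eta_mul_conn (he : IsTetrad U g e γ) (hx : x ∈ U) (c a b : Fin 4) :
    eta c c * conn γ x c a b = -(eta a a * conn γ x a c b) := by
  rw [conn_eq, conn_eq, ← mul_assoc, eta_mul_self, ← mul_assoc (eta a a), eta_mul_self,
    he.comm_antisymm hx b a c, he.comm_antisymm hx c a b]
  ring

lemma contMDiffOn_curv (he : IsTetrad U g e γ) (hU : IsOpen U) (a b c d : Fin 4) :
    ContMDiffOn (𝓡 4) 𝓘(ℝ, ℝ) ∞ (fun x => curv e γ x a b c d) U := by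
  have hΓ := he.contMDiffOn_conn
  exact ((he.contMDiffOn_dirD hU (hΓ a b d) c).sub (he.contMDiffOn_dirD hU (hΓ a b c) d)).add
    (contMDiffOn_finsetSum fun f _ => (((hΓ f b d).mul (hΓ a f c)).sub
      ((hΓ f b c).mul (hΓ a f d))).sub ((he.smooth_comm f c d).mul (hΓ a b f)))

lemma hasDirD_conn (he : IsTetrad U g e γ) (hU : IsOpen U) (hx : x ∈ U) (k a b c : Fin 4) :
    HasDirD e k (fun y => conn γ y a b c) (dirD e k (fun y => conn γ y a b c) x) x :=
  hasDirD_of_contMDiffOn hU hx (he.contMDiffOn_conn a b c)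

end IsTetrad

end Tetrad

section Curvature

attribute [local instance] LieRing.ofAssociativeRing

variable {M : Type*} [TopologicalSpace M] [ChartedSpace (EuclideanSpace ℝ (Fin 4)) M]
  {e : Fin 4 → ∀ x : M, TangentSpace (𝓡 4) x} {γ : M → Fin 4 → Fin 4 → Fin 4 → ℝ} {x : M}

lemma gradU_eq (a b : Fin 4) : gradU e γ x a b = conn γ x a 0 b := by
  rw [gradU, covD1, (hasDirD_const _).2]
  simp [uUp]

lemma ricciRes_eq (R : M → Fin 4 → Fin 4 → Fin 4 → Fin 4 → ℝ) (a c d : Fin 4) :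
    ricciRes e γ R a c d x
      = covD11 e γ (gradU e γ) x a c d - covD11 e γ (gradU e γ) x a d c - R x a 0 d c := by
  simp [ricciRes, uUp]

lemma mem_skewAdjoint_eta {A : Matrix (Fin 4) (Fin 4) ℝ} :
    A ∈ skewAdjointMatricesLieSubalgebra (Matrix.of eta)
      ↔ ∀ a b, eta a a * A a b = -(eta b b * A b a) := by
  have hright (B : Matrix (Fin 4) (Fin 4) ℝ) (a b : Fin 4) :
      (B * Matrix.of eta) a b = eta b b * B a b := by
    simp [Matrix.mul_apply, eta, mul_comm]
  have hleft (B : Matrix (Fin 4) (Fin 4) ℝ) (a b : Fin 4) :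
      (Matrix.of eta * B) a b = eta a a * B a b := sum_eta_mul a (B · b)
  rw [mem_skewAdjointMatricesLieSubalgebra, mem_skewAdjointMatricesSubmodule,
    Matrix.IsSkewAdjoint, Matrix.IsAdjointPair, ← Matrix.ext_iff]
  simp only [hright, hleft, Matrix.transpose_apply, Matrix.neg_apply, mul_neg]
  exact forall₂_congr fun a b => by rw [eq_neg_iff_add_eq_zero, eq_neg_iff_add_eq_zero, add_comm]

variable [IsManifold (𝓡 4) ∞ M] {U : Set M}
  {g : ∀ x : M, LinearMap.BilinForm ℝ (TangentSpace (𝓡 4) x)}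

namespace IsTetrad

lemma curv_antisymm_right (he : IsTetrad U g e γ) (hx : x ∈ U) (a b c d : Fin 4) :
    curv e γ x a b c d = -curv e γ x a b d c := by
  simp only [curv, he.comm_antisymm hx _ c d, neg_add, neg_sub, ← Finset.sum_neg_distrib]
  congr! 2
  ring

lemma connMatrix_mem (he : IsTetrad U g e γ) (hx : x ∈ U) (c : Fin 4) :
    connMatrix γ c x ∈ skewAdjointMatricesLieSubalgebra (Matrix.of eta) :=
  mem_skewAdjoint_eta.2 fun a b => he.eta_mul_conn hx a b c

lemma dirDMatrix_connMatrix_mem (he : IsTetrad U g e γ) (hU : IsOpen U) (hx : x ∈ U)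
    (k c : Fin 4) :
    dirDMatrix e k (connMatrix γ c) x ∈ skewAdjointMatricesLieSubalgebra (Matrix.of eta) :=
  mem_skewAdjoint_eta.2 fun a b =>
    ((he.hasDirD_conn hU hx k a b c).const_mul (eta a a)).2.symm.trans
      ((dirD_congr_of_eqOn hU hx fun _ hy => he.eta_mul_conn hy a b c).trans
        ((he.hasDirD_conn hU hx k b a c).const_mul (eta b b)).neg.2)

lemma curvMatrix_mem (he : IsTetrad U g e γ) (hU : IsOpen U) (hx : x ∈ U) (c d : Fin 4) :
    curvMatrix e γ c d x ∈ skewAdjointMatricesLieSubalgebra (Matrix.of eta) := by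
  rw [curvMatrix_eq]
  exact sub_mem (add_mem (sub_mem (he.dirDMatrix_connMatrix_mem hU hx c d)
    (he.dirDMatrix_connMatrix_mem hU hx d c)) (LieSubalgebra.lie_mem _ (he.connMatrix_mem hx c)
    (he.connMatrix_mem hx d))) (sum_mem fun f _ => SMulMemClass.smul_mem _ (he.connMatrix_mem hx f))

lemma lower_curv_antisymm_left (he : IsTetrad U g e γ) (hU : IsOpen U) (hx : x ∈ U)
    (a b c d : Fin 4) : lower (curv e γ x) a b c d = -lower (curv e γ x) b a c d := by
  simpa only [lower_eq] using! mem_skewAdjoint_eta.1 (he.curvMatrix_mem hU hx c d) a b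

lemma curv_cyclic_sum (he : IsTetrad U g e γ) (hU : IsOpen U) (hx : x ∈ U)
    (a b c d : Fin 4) :
    curv e γ x a b c d + curv e γ x a c d b + curv e γ x a d b c = 0 := by
  have hγ := he.comm_eq_conn_sub_conn hx
  have hdγ (k b c : Fin 4) : dirD e k (fun y => γ y a b c) x
      = dirD e k (fun y => conn γ y a c b) x - dirD e k (fun y => conn γ y a b c) x :=
    (dirD_congr_of_eqOn hU hx fun _ hy => he.comm_eq_conn_sub_conn hy a b c).trans
      ((he.hasDirD_conn hU hx k a c b).sub (he.hasDirD_conn hU hx k a b c)).2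
  have hjacobi := he.jacobi hU hx a b c d
  simp only [hdγ, hγ, Fin.sum_univ_four] at hjacobi
  simp only [curv, hγ, Fin.sum_univ_four]
  linear_combination hjacobi

lemma dirDMatrix_curvMatrix (he : IsTetrad U g e γ) (hU : IsOpen U) (hx : x ∈ U)
    (k c d : Fin 4) :
    dirDMatrix e k (curvMatrix e γ c d) x
      = dirDMatrix e k (dirDMatrix e c (connMatrix γ d)) x
        - dirDMatrix e k (dirDMatrix e d (connMatrix γ c)) x
        + (⁅dirDMatrix e k (connMatrix γ c) x, connMatrix γ d x⁆
          + ⁅connMatrix γ c x, dirDMatrix e k (connMatrix γ d) x⁆)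
        - ∑ f, (dirD e k (fun y => γ y f c d) x • connMatrix γ f x
          + γ x f c d • dirDMatrix e k (connMatrix γ f) x) := by
  ext a b
  have hΓ (a b c : Fin 4) := he.hasDirD_conn hU hx k a b c
  have hdΓ (c d : Fin 4) := hasDirD_of_contMDiffOn (e := e) (a := k) hU hx
    (he.contMDiffOn_dirD hU (he.contMDiffOn_conn a b d) c)
  have hγ (f : Fin 4) := hasDirD_of_contMDiffOn (e := e) (a := k) hU hx (he.smooth_comm f c d)
  refine (((hdΓ c d).sub (hdΓ d c)).add (.sum fun f _ => (((hΓ f b d).mul (hΓ a f c)).sub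
    ((hΓ f b c).mul (hΓ a f d))).sub ((hγ f).mul (hΓ a b f)))).2.trans ?_
  simp only [dirDMatrix, connMatrix, Ring.lie_def, Matrix.of_apply, Matrix.add_apply,
    Matrix.sub_apply, Matrix.mul_apply, Matrix.sum_apply, Matrix.smul_apply, smul_eq_mul,
    Finset.sum_sub_distrib, Finset.sum_add_distrib, mul_comm (conn γ x a _ _),
    mul_comm (dirD e k (fun y => conn γ y a _ _) x)]
  ring

lemma covD13_curv_cyclic_sum (he : IsTetrad U g e γ) (hU : IsOpen U) (hx : x ∈ U)
    (a b c d k : Fin 4) :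
    covD13 e γ (curv e γ) x a b c d k + covD13 e γ (curv e γ) x a b d k c
      + covD13 e γ (curv e γ) x a b k c d = 0 := by
  have hbianchi := bianchi_second_of_jacobi (he.comm_antisymm hx)
    (fun k c d => Matrix.ext fun a b => by
      simpa only [Matrix.sum_apply, Matrix.smul_apply] using!
        he.dirD_dirD_sub hU hx (he.contMDiffOn_conn a b d) k c)
    (he.jacobi hU hx) curvMatrix_eq (he.dirDMatrix_curvMatrix hU hx) c d k
  have hentry := congrFun₂ hbianchi a b
  simp only [curvMatrix, connMatrix, dirDMatrix, Ring.lie_def, Matrix.of_apply, Matrix.add_apply,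
    Matrix.sub_apply, Matrix.mul_apply, Matrix.sum_apply, Matrix.smul_apply, Matrix.zero_apply,
    smul_eq_mul, he.comm_eq_conn_sub_conn hx, sub_mul, Finset.sum_sub_distrib,
    mul_comm (curv e γ x a _ _ _)] at hentry
  simp only [covD13, Finset.sum_sub_distrib, he.curv_antisymm_right hx a b _ c,
    he.curv_antisymm_right hx a b _ d, he.curv_antisymm_right hx a b _ k, mul_neg,
    Finset.sum_neg_distrib]
  linear_combination hentry

lemma ricciRes_curv (he : IsTetrad U g e γ) (hx : x ∈ U) (a c d : Fin 4) :
    ricciRes e γ (curv e γ) a c d x = 0 := by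
  simp only [ricciRes_eq, covD11, gradU_eq, curv,
    he.comm_eq_conn_sub_conn hx, sub_mul, Finset.sum_sub_distrib, mul_comm (conn γ x a _ _)]
  ring

lemma isCurvatureLike_curv (he : IsTetrad U g e γ) (hU : IsOpen U) :
    IsCurvatureLike U e γ (curv e γ) := by
  have hr {x : M} (hx : x ∈ U) (a b c d : Fin 4) :
      lower (curv e γ x) a b c d = -lower (curv e γ x) a b d c := by
    rw [lower_eq, lower_eq, he.curv_antisymm_right hx, mul_neg]
  have hc {x : M} (hx : x ∈ U) (a b c d : Fin 4) : lower (curv e γ x) a b c d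
      + lower (curv e γ x) a c d b + lower (curv e γ x) a d b c = 0 := by
    rw [lower_eq, lower_eq, lower_eq, ← mul_add, ← mul_add, he.curv_cyclic_sum hU hx, mul_zero]
  exact
    { smooth := he.contMDiffOn_curv hU
      antisymm_left := fun _ hx => he.lower_curv_antisymm_left hU hx
      antisymm_right := fun _ hx => hr hx
      symm_pair := fun _ hx =>
        pair_symm_of_cyclic_sum (he.lower_curv_antisymm_left hU hx) (hr hx) (hc hx)
      bianchi_first := fun _ hx a => alt3_eq_zero_of_cyclic_sum (hc hx a)
      bianchi_second := fun _ hx a b =>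
        alt3_eq_zero_of_cyclic_sum (he.covD13_curv_cyclic_sum hU hx a b)
      ricci := fun _ hx => he.ricciRes_curv hx }

end IsTetrad
end Curvature

section Bivectors

lemma eta_comm (a b : Fin 4) : eta a b = eta b a := by
  simp only [eta, eq_comm (a := a)]
  split_ifs <;> simp_all

lemma eta_zero_zero : eta 0 0 = -1 := by simp [eta]

lemma eta_succ_succ (i j : Fin 3) : eta i.succ j.succ = if i = j then 1 else 0 := by
  simp [eta]

lemma uLow_zero : uLow 0 = -1 := by simp [uLow, uUp, eta]

lemma uLow_succ (i : Fin 3) : uLow i.succ = 0 := by simp [uLow, uUp, eta]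

lemma hLow_comm (a b : Fin 4) : hLow a b = hLow b a := by
  rw [hLow, hLow, eta_comm, mul_comm (uLow a)]

lemma hLow_zero (a : Fin 4) : hLow a 0 = 0 := by
  cases a using Fin.cases <;> simp [hLow, uLow_zero, uLow_succ, eta]

lemma hLow_succ_succ (i j : Fin 3) : hLow i.succ j.succ = if i = j then 1 else 0 := by
  simp [hLow, uLow_succ, eta_succ_succ]

lemma eps_eq_leviCivita (a b c : Fin 4) : eps a b c = leviCivita a b c 0 := by
  simp [eps, uUp]

lemma leviCivita_perm (v : Fin 4 → Fin 4) (σ : Equiv.Perm (Fin 4)) :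
    leviCivita (v (σ 0)) (v (σ 1)) (v (σ 2)) (v (σ 3))
      = (Equiv.Perm.sign σ : ℤ) * leviCivita (v 0) (v 1) (v 2) (v 3) := by
  have hrows (w : Fin 4 → Fin 4) : ![w 0, w 1, w 2, w 3] = w := by
    ext i
    fin_cases i <;> rfl
  have hdet := Matrix.det_permute σ (Matrix.of fun i j => if v i = j then (1 : ℤ) else 0)
  simp only [leviCivita, hrows, hrows fun i => v (σ i), mul_neg, ← Int.cast_mul, neg_inj,
    Int.cast_inj]
  exact hdet

lemma eps_swap (a b c : Fin 4) : eps b a c = -eps a b c := by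
  simpa [eps_eq_leviCivita, Equiv.swap_apply_of_ne_of_ne] using!
    leviCivita_perm ![a, b, c, 0] (Equiv.swap 0 1)

lemma eps_zero (a b : Fin 4) : eps 0 a b = 0 := by
  have h : leviCivita 0 a b 0 = -leviCivita 0 a b 0 := by
    simpa [Equiv.swap_apply_of_ne_of_ne] using!
      leviCivita_perm ![0, a, b, 0] (Equiv.swap 0 3)
  rw [eps_eq_leviCivita]
  linarith

lemma leviCivita_zero_second (a b c : Fin 4) : leviCivita a 0 b c = eps a b c := by
  have hσ : Equiv.Perm.sign (Equiv.swap (2 : Fin 4) 3 * Equiv.swap 1 2) = 1 := by decide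
  have h := leviCivita_perm ![a, b, c, 0] (Equiv.swap 2 3 * Equiv.swap 1 2)
  rw [hσ, Units.val_one, Int.cast_one, one_mul] at h
  exact h.trans (eps_eq_leviCivita a b c).symm

lemma eps_succ (i : Fin 3) (a b : Fin 4) :
    eps i.succ a b = (if a = (i + 1).succ ∧ b = (i + 2).succ then 1 else 0)
      - (if a = (i + 2).succ ∧ b = (i + 1).succ then 1 else 0) := by
  simp only [eps_eq_leviCivita, leviCivita, Matrix.det_succ_row_zero, Fin.sum_univ_succ]
  norm_cast
  revert i a b
  decide

lemma eps_succ_succ (i : Fin 3) (a : Fin 4) :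
    eps (i + 1).succ (i + 2).succ a = if a = i.succ then 1 else 0 := by
  have hne : i + 2 ≠ i := by revert i; decide
  simp [eps_succ, add_assoc, hne]

end Bivectors

section BivectorForm

/-- The array `C_abcd` is a symmetric bilinear form on bivectors: it has the symmetries of a
Riemann tensor, except possibly the cyclic identity. -/
structure IsBivectorForm {ι : Type*} (C : ι → ι → ι → ι → ℝ) : Prop where
  antisymm_left : ∀ a b c d, C a b c d = -C b a c d
  antisymm_right : ∀ a b c d, C a b c d = -C a b d c
  symm_pair : ∀ a b c d, C a b c d = C c d a b

/-- The array `S_ab` is symmetric and orthogonal to `u = e_0`. -/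
structure IsSpatial (S : Fin 4 → Fin 4 → ℝ) : Prop where
  symm : ∀ a b, S a b = S b a
  apply_zero : ∀ a, S a 0 = 0

/-- The spatial part `(1/4) ε_ikl ε_jmn C_klmn` of a form on bivectors, as a `3 × 3` array. The
indices are taken modulo `3`, so that `ε_i(i+1)(i+2) = 1`. -/
def spatialPart (C : Fin 4 → Fin 4 → Fin 4 → Fin 4 → ℝ) (i j : Fin 3) : ℝ :=
  C (i + 1).succ (i + 2).succ (j + 1).succ (j + 2).succ

lemma sum_univ_three_cyclic {N : Type*} [AddCommMonoid N] (f : Fin 3 → N) (i : Fin 3) :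
    ∑ j, f j = f i + f (i + 1) + f (i + 2) := by
  rw [← Equiv.sum_comp (Equiv.addLeft i) f, Fin.sum_univ_three]
  simp

lemma eq_or_eq_add_one_or_eq_add_two (i j : Fin 3) : i = j ∨ j = i + 1 ∨ j = i + 2 := by
  revert i j
  decide

lemma rel_of_rel_add_one_add_two {r : Fin 3 → Fin 3 → Prop} (hrefl : ∀ i, r i i)
    (hsymm : ∀ i j, r i j → r j i) (hcyclic : ∀ i, r (i + 1) (i + 2)) (i j : Fin 3) : r i j := by
  obtain rfl | rfl | rfl := eq_or_eq_add_one_or_eq_add_two i j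
  · exact hrefl i
  · simpa [add_assoc] using hcyclic (i + 2)
  · simpa [add_assoc] using hsymm _ _ (hcyclic (i + 1))

lemma IsSpatial.trace2_eq {S : Fin 4 → Fin 4 → ℝ} (hS : IsSpatial S) :
    trace2 S = ∑ i : Fin 3, S i.succ i.succ := by
  have hdiag : trace2 S = ∑ a, eta a a * S a a :=
    Finset.sum_congr rfl fun a _ => sum_eta_mul a (S a)
  simp only [hdiag, Fin.sum_univ_succ (n := 3), hS.apply_zero, eta_succ_succ, if_true, mul_zero,
    one_mul, zero_add]

lemma IsSpatial.zero_apply {S : Fin 4 → Fin 4 → ℝ} (hS : IsSpatial S) (a : Fin 4) :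
    S 0 a = 0 := by
  rw [hS.symm, hS.apply_zero]

lemma electric_eq (C : Fin 4 → Fin 4 → Fin 4 → Fin 4 → ℝ) (a b : Fin 4) :
    electric C a b = C a 0 b 0 := by
  simp [electric, uUp]

lemma magnetic_eq (C : Fin 4 → Fin 4 → Fin 4 → Fin 4 → ℝ) (a b : Fin 4) :
    magnetic C a b = (1 / 2) * ∑ m, ∑ n, eps a m n * (eta m m * eta n n) * C m n b 0 := by
  have hcontract (c d : Fin 4) : ∑ e, ∑ f, ∑ m, ∑ n,
      leviCivita a c m n * eta m e * eta n f * C e f b d * uUp c * uUp d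
      = ∑ m, ∑ n, leviCivita a c m n * (eta m m * eta n n) * C m n b d * uUp c * uUp d := by
    refine Finset.sum_congr rfl fun e _ => Finset.sum_congr rfl fun f _ => ?_
    rw [Finset.sum_eq_single e, Finset.sum_eq_single f, mul_assoc (leviCivita _ _ _ _)]
    · intro n _ hn
      simp [eta, hn]
    · simp
    · intro m _ hm
      simp [eta, hm]
    · simp
  simp only [magnetic, hcontract]
  simp [uUp, leviCivita_zero_second]

lemma magnetic_zero (C : Fin 4 → Fin 4 → Fin 4 → Fin 4 → ℝ) (b : Fin 4) :
    magnetic C 0 b = 0 := by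
  simp [magnetic_eq, eps_zero]

lemma eq_of_antisymm {F G : Fin 4 → Fin 4 → ℝ} (hF : ∀ a b, F a b = -F b a)
    (hG : ∀ a b, G a b = -G b a) (htime : ∀ i : Fin 3, F i.succ 0 = G i.succ 0)
    (hspace : ∀ i : Fin 3, F (i + 1).succ (i + 2).succ = G (i + 1).succ (i + 2).succ) :
    F = G := by
  have hdiag (a : Fin 4) : F a a = G a a := by linarith [hF a a, hG a a]
  have hswap {a b : Fin 4} (h : F a b = G a b) : F b a = G b a := by rw [hF, hG, h]
  funext a b
  cases a using Fin.cases with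
  | zero => cases b using Fin.cases with
    | zero => exact hdiag 0
    | succ j => exact hswap (htime j)
  | succ i => cases b using Fin.cases with
    | zero => exact htime i
    | succ j =>
      exact rel_of_rel_add_one_add_two (r := fun i j => F i.succ j.succ = G i.succ j.succ)
        (fun i => hdiag i.succ) (fun _ _ => hswap) hspace i j

namespace IsBivectorForm

variable {C D : Fin 4 → Fin 4 → Fin 4 → Fin 4 → ℝ}

lemma add {ι : Type*} {C D : ι → ι → ι → ι → ℝ} (hC : IsBivectorForm C)
    (hD : IsBivectorForm D) : IsBivectorForm fun a b c d => C a b c d + D a b c d where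
  antisymm_left a b c d := by rw [hC.antisymm_left, hD.antisymm_left, neg_add]
  antisymm_right a b c d := by rw [hC.antisymm_right, hD.antisymm_right, neg_add]
  symm_pair a b c d := by rw [hC.symm_pair, hD.symm_pair]

lemma sub {ι : Type*} {C D : ι → ι → ι → ι → ℝ} (hC : IsBivectorForm C)
    (hD : IsBivectorForm D) : IsBivectorForm fun a b c d => C a b c d - D a b c d where
  antisymm_left a b c d := by rw [hC.antisymm_left, hD.antisymm_left, neg_sub_neg, neg_sub]
  antisymm_right a b c d := by rw [hC.antisymm_right, hD.antisymm_right, neg_sub_neg, neg_sub]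
  symm_pair a b c d := by rw [hC.symm_pair, hD.symm_pair]

lemma apply_self_left {ι : Type*} {C : ι → ι → ι → ι → ℝ} (hC : IsBivectorForm C) (a c d : ι) :
    C a a c d = 0 := by
  linarith [hC.antisymm_left a a c d]

lemma apply_self_right {ι : Type*} {C : ι → ι → ι → ι → ℝ} (hC : IsBivectorForm C) (a b c : ι) :
    C a b c c = 0 := by
  linarith [hC.antisymm_right a b c c]

lemma magnetic_succ (hC : IsBivectorForm C) (i : Fin 3) (b : Fin 4) :
    magnetic C i.succ b = C (i + 1).succ (i + 2).succ b 0 := by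
  simp only [magnetic_eq, eps_succ, sub_mul, Finset.sum_sub_distrib, ite_and, ite_mul, one_mul,
    zero_mul, Finset.sum_ite_eq', Finset.sum_ite_irrel, Finset.sum_const_zero, Finset.mem_univ,
    if_true, eta_succ_succ, mul_one]
  linarith [hC.antisymm_left (i + 1).succ (i + 2).succ b 0]

lemma electric_isSpatial (hC : IsBivectorForm C) : IsSpatial (electric C) where
  symm a b := by rw [electric_eq, electric_eq, hC.symm_pair]
  apply_zero a := by rw [electric_eq, hC.apply_self_right]

lemma magnetic_apply_zero (hC : IsBivectorForm C) (a : Fin 4) : magnetic C a 0 = 0 := by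
  cases a using Fin.cases with
  | zero => exact magnetic_zero C 0
  | succ i => rw [hC.magnetic_succ, hC.apply_self_right]

protected lemma ext (hC : IsBivectorForm C) (hD : IsBivectorForm D)
    (helectric : electric C = electric D) (hmagnetic : magnetic C = magnetic D)
    (hspatial : spatialPart C = spatialPart D) : C = D := by
  have htt (a c : Fin 4) : C a 0 c 0 = D a 0 c 0 := by
    rw [← electric_eq C, ← electric_eq D, helectric]
  have hst (i : Fin 3) (c : Fin 4) :
      C (i + 1).succ (i + 2).succ c 0 = D (i + 1).succ (i + 2).succ c 0 := by
    rw [← hC.magnetic_succ, ← hD.magnetic_succ, hmagnetic]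
  have htime (a c d : Fin 4) : C a 0 c d = D a 0 c d :=
    congrFun₂ (eq_of_antisymm (hC.antisymm_right a 0) (hD.antisymm_right a 0)
      (fun j => htt a j.succ) fun j => by rw [hC.symm_pair, hD.symm_pair, hst]) c d
  have hspace (i : Fin 3) (c d : Fin 4) :
      C (i + 1).succ (i + 2).succ c d = D (i + 1).succ (i + 2).succ c d :=
    congrFun₂ (eq_of_antisymm (hC.antisymm_right _ _) (hD.antisymm_right _ _)
      (fun j => hst i j.succ) fun j => congrFun₂ hspatial i j) c d
  funext a b c d
  exact congrFun₂ (eq_of_antisymm (F := (C · · c d)) (hC.antisymm_left · · c d)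
    (hD.antisymm_left · · c d) (fun i => htime i.succ c d) fun i => hspace i c d) a b

end IsBivectorForm
end BivectorForm

section Weyl

variable {E H S : Fin 4 → Fin 4 → ℝ} {C R : Fin 4 → Fin 4 → Fin 4 → Fin 4 → ℝ}

lemma isBivectorForm_ricciPart (hS : ∀ a b, S a b = S b a) : IsBivectorForm (ricciPart S) where
  antisymm_left a b c d := by
    rw [ricciPart, ricciPart, eta_comm d b, eta_comm c b, eta_comm d a, eta_comm c a]
    ring
  antisymm_right a b c d := by
    rw [ricciPart, ricciPart]
    ring
  symm_pair a b c d := by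
    rw [ricciPart, ricciPart, eta_comm c a, eta_comm c b, eta_comm d b, eta_comm d a,
      hS b d, hS a d, hS a c, hS b c, eta_comm b c]
    ring

lemma weylOf_eq (E H : Fin 4 → Fin 4 → ℝ) (a b c d : Fin 4) :
    weylOf E H a b c d
      = (uLow a * uLow c + hLow a c) * E b d - (uLow b * uLow c + hLow b c) * E a d
        - (uLow a * uLow d + hLow a d) * E b c + (uLow b * uLow d + hLow b d) * E a c
        + ∑ e, eps a b e * eta e e * (uLow c * H d e - uLow d * H c e)
        + ∑ e, eps c d e * eta e e * (uLow a * H b e - uLow b * H a e) := by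
  have hcontract (t v : Fin 4 → ℝ) : ∑ e, ∑ f, t e * eta e f * v f = ∑ e, t e * eta e e * v e :=
    Finset.sum_congr rfl fun e _ => by
      simp only [mul_assoc, ← Finset.mul_sum, sum_eta_mul]
  rw [weylOf, hcontract (eps a b) fun f => uLow c * H d f - uLow d * H c f,
    hcontract (eps c d) fun f => uLow a * H b f - uLow b * H a f]

lemma isBivectorForm_weylOf (hE : ∀ a b, E a b = E b a) : IsBivectorForm (weylOf E H) where
  antisymm_left a b c d := by
    simp only [weylOf_eq, eps_swap a b, Fin.sum_univ_four]
    ring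
  antisymm_right a b c d := by
    simp only [weylOf_eq, eps_swap c d, Fin.sum_univ_four]
    ring
  symm_pair a b c d := by
    rw [weylOf, weylOf, hLow_comm c a, hLow_comm d a, hLow_comm c b, hLow_comm d b, hE d b,
      hE c b, hE d a, hE c a]
    ring

lemma electric_weylOf (hE : IsSpatial E) : electric (weylOf E H) = E := by
  funext a b
  have heps (a b : Fin 4) : eps a 0 b = 0 := by rw [eps_swap, eps_zero, neg_zero]
  simp [electric_eq, weylOf_eq, uLow_zero, hLow_zero, hLow_comm 0, hE.apply_zero, hE.zero_apply,
    heps]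

lemma magnetic_weylOf (hE : IsSpatial E) (hH : IsSpatial H) : magnetic (weylOf E H) = H := by
  funext a b
  cases a using Fin.cases with
  | zero => rw [magnetic_zero, hH.zero_apply]
  | succ i =>
    have heps (a b : Fin 4) : eps a 0 b = 0 := by rw [eps_swap, eps_zero, neg_zero]
    rw [(isBivectorForm_weylOf hE.symm).magnetic_succ]
    simp [weylOf_eq, uLow_zero, uLow_succ, hLow_zero, hE.apply_zero, heps, eps_succ_succ,
      eta_succ_succ, hH.symm b, hH.zero_apply]

lemma spatialPart_weylOf (hE : IsSpatial E) (htr : trace2 E = 0) (i j : Fin 3) :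
    spatialPart (weylOf E H) i j = -E i.succ j.succ := by
  have htrace : E 1 1 + E 2 2 + E 3 3 = 0 := by
    simpa [hE.trace2_eq, Fin.sum_univ_three] using htr
  simp only [spatialPart, weylOf_eq, uLow_succ, hLow_succ_succ]
  fin_cases i <;> fin_cases j <;> simp <;>
    linarith [hE.symm 1 2, hE.symm 1 3, hE.symm 2 3]

lemma ricci_raise (C : Fin 4 → Fin 4 → Fin 4 → Fin 4 → ℝ) (b d : Fin 4) :
    ricci (raise C) b d = -C 0 b 0 d + ∑ i : Fin 3, C i.succ b i.succ d := by
  have hcontract : ricci (raise C) b d = ∑ c, eta c c * C c b c d :=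
    Finset.sum_congr rfl fun c _ => sum_eta_mul c fun e => C e b c d
  simp only [hcontract, Fin.sum_univ_succ (n := 3), eta_zero_zero, eta_succ_succ, if_true, one_mul,
    neg_mul]

namespace IsBivectorForm

lemma ricci_raise_symm (hC : IsBivectorForm C) (b d : Fin 4) :
    ricci (raise C) b d = ricci (raise C) d b := by
  simp only [ricci_raise, hC.symm_pair _ b]

lemma ricci_raise_zero_zero (hC : IsBivectorForm C) :
    ricci (raise C) 0 0 = trace2 (electric C) := by
  simp only [ricci_raise, hC.electric_isSpatial.trace2_eq, electric_eq, hC.apply_self_left,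
    neg_zero, zero_add]

lemma ricci_raise_zero_succ (hC : IsBivectorForm C) (i : Fin 3) :
    ricci (raise C) 0 i.succ = magnetic C (i + 1).succ (i + 2).succ
      - magnetic C (i + 2).succ (i + 1).succ := by
  simp only [ricci_raise, sum_univ_three_cyclic _ i, hC.magnetic_succ, hC.apply_self_left,
    hC.apply_self_right, add_assoc, Fin.reduceAdd, add_zero]
  linarith [hC.symm_pair (i + 1).succ 0 (i + 1).succ i.succ,
    hC.symm_pair (i + 2).succ 0 (i + 2).succ i.succ,
    hC.antisymm_left (i + 1).succ i.succ (i + 1).succ 0]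

lemma ricci_raise_succ_succ (hC : IsBivectorForm C) (i j : Fin 3) :
    ricci (raise C) i.succ j.succ = -electric C i.succ j.succ - spatialPart C i j
      + if i = j then ∑ k, spatialPart C k k else 0 := by
  have htime : C 0 i.succ 0 j.succ = C i.succ 0 j.succ 0 := by
    rw [hC.antisymm_left, hC.antisymm_right, neg_neg]
  obtain rfl | rfl | rfl := eq_or_eq_add_one_or_eq_add_two i j
  all_goals
    simp only [ricci_raise, sum_univ_three_cyclic _ i, spatialPart, htime, electric_eq, add_assoc,
      Fin.reduceAdd, add_zero, hC.apply_self_left, hC.apply_self_right, if_true]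
  · linarith [hC.antisymm_left (i + 1).succ i.succ (i + 1).succ i.succ,
      hC.antisymm_right i.succ (i + 1).succ (i + 1).succ i.succ]
  · rw [if_neg (by simp)]
    linarith [hC.symm_pair (i + 2).succ i.succ (i + 2).succ (i + 1).succ,
      hC.antisymm_left (i + 2).succ (i + 1).succ (i + 2).succ i.succ]
  · rw [if_neg (by simp)]
    linarith [hC.symm_pair (i + 1).succ i.succ (i + 1).succ (i + 2).succ,
      hC.antisymm_right (i + 1).succ (i + 2).succ (i + 1).succ i.succ]

lemma ricci_raise_eq_zero_iff (hC : IsBivectorForm C) :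
    ricci (raise C) = 0 ↔ trace2 (electric C) = 0 ∧ IsSpatial (magnetic C)
      ∧ ∀ i j, spatialPart C i j = -electric C i.succ j.succ := by
  have htrace := hC.electric_isSpatial.trace2_eq
  constructor
  · intro h
    have hspace (i j : Fin 3) := hC.ricci_raise_succ_succ i j
    simp only [h, Pi.zero_apply] at hspace
    have helectric : trace2 (electric C) = 0 := by rw [← hC.ricci_raise_zero_zero, h]; rfl
    have hspatial : ∑ k, spatialPart C k k = 0 := by
      have hdiag (i : Fin 3) := hspace i i
      simp only [if_true, Fin.sum_univ_three] at hdiag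
      have hsum := htrace ▸ helectric
      rw [Fin.sum_univ_three] at hsum ⊢
      linarith [hdiag 0, hdiag 1, hdiag 2]
    have hmagnetic : (fun a b => magnetic C a b - magnetic C b a) = 0 :=
      eq_of_antisymm (fun _ _ => (neg_sub _ _).symm) (fun _ _ => neg_zero.symm)
        (fun i => by simp [magnetic_zero, hC.magnetic_apply_zero])
        fun i => by simp [← hC.ricci_raise_zero_succ, h]
    refine ⟨helectric, ⟨fun a b => sub_eq_zero.1 (congrFun₂ hmagnetic a b),
      hC.magnetic_apply_zero⟩, fun i j => ?_⟩
    have hij := hspace i j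
    rw [hspatial, ite_self] at hij
    linarith
  · rintro ⟨helectric, hmagnetic, hspatial⟩
    have hmixed (i : Fin 3) : ricci (raise C) 0 i.succ = 0 := by
      rw [hC.ricci_raise_zero_succ, hmagnetic.symm, sub_self]
    funext b d
    cases b using Fin.cases with
    | zero => cases d using Fin.cases with
      | zero => rw [hC.ricci_raise_zero_zero, helectric]; rfl
      | succ j => exact hmixed j
    | succ i => cases d using Fin.cases with
      | zero => rw [hC.ricci_raise_symm]; exact hmixed i
      | succ j => simp [hC.ricci_raise_succ_succ, hspatial, ← htrace, helectric]

lemma eq_weylOf (hC : IsBivectorForm C) (hricci : ricci (raise C) = 0) :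
    C = weylOf (electric C) (magnetic C) := by
  obtain ⟨htrace, hmagnetic, hspatial⟩ := hC.ricci_raise_eq_zero_iff.1 hricci
  have helectric := hC.electric_isSpatial
  refine hC.ext (isBivectorForm_weylOf helectric.symm) (electric_weylOf helectric).symm
    (magnetic_weylOf helectric hmagnetic).symm ?_
  funext i j
  rw [hspatial, spatialPart_weylOf helectric htrace]

end IsBivectorForm

lemma ricci_raise_weylOf (hE : IsSpatial E) (hH : IsSpatial H) (htr : trace2 E = 0) :
    ricci (raise (weylOf E H)) = 0 := by
  rw [(isBivectorForm_weylOf hE.symm).ricci_raise_eq_zero_iff, electric_weylOf hE,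
    magnetic_weylOf hE hH]
  exact ⟨htr, hH, spatialPart_weylOf hE htr⟩

lemma ricci_raise_ricciPart (hS : ∀ a b, S a b = S b a) : ricci (raise (ricciPart S)) = S := by
  funext b d
  rw [ricci_raise, hS b d]
  simp only [ricciPart, trace2, Fin.sum_univ_succ, Fin.sum_univ_zero]
  fin_cases b <;> fin_cases d <;> simp [eta] <;> ring

end Weyl

section Einstein

variable {E H T : Fin 4 → Fin 4 → ℝ} {R : Fin 4 → Fin 4 → Fin 4 → Fin 4 → ℝ}

lemma lower_raise (C : Fin 4 → Fin 4 → Fin 4 → Fin 4 → ℝ) : lower (raise C) = C := by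
  funext a b c d
  have hraise : raise C a b c d = eta a a * C a b c d := sum_eta_mul a fun e => C e b c d
  rw [lower_eq, hraise, ← mul_assoc, eta_mul_self, one_mul]

lemma raise_lower (R : Fin 4 → Fin 4 → Fin 4 → Fin 4 → ℝ) : raise (lower R) = R :=
  lower_raise R

lemma ricci_raise_add (C D : Fin 4 → Fin 4 → Fin 4 → Fin 4 → ℝ) :
    ricci (raise (C + D)) = ricci (raise C) + ricci (raise D) := by
  funext b d
  simp only [ricci, raise, Pi.add_apply, mul_add, Finset.sum_add_distrib]

lemma ricciOf_symm (hT : ∀ a b, T a b = T b a) (a b : Fin 4) : ricciOf T a b = ricciOf T b a := by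
  rw [ricciOf, ricciOf, hT, eta_comm]

lemma einsteinEq_iff : EinsteinEq R T ↔ ricci R = ricciOf T := by
  have htr (S : Fin 4 → Fin 4 → ℝ) (t : ℝ) :
      trace2 (fun a b => S a b - 1 / 2 * t * eta a b) = trace2 S - 2 * t := by
    have heta : ∑ a, ∑ b, eta a b * eta a b = 4 := by
      simp [sum_eta_mul, eta_mul_self]
    simp only [trace2, mul_sub, mul_left_comm (eta _ _), Finset.sum_sub_distrib, ← Finset.mul_sum,
      heta]
    ring
  constructor
  · intro h
    have hT : T = fun a b => ricci R a b - 1 / 2 * trace2 (ricci R) * eta a b :=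
      funext₂ fun a b => (h a b).symm
    funext a b
    rw [ricciOf, hT, htr]
    ring
  · intro h a b
    have htrace : trace2 (ricci R) = trace2 T - 2 * trace2 T := by
      rw [h]
      exact htr T (trace2 T)
    rw [htrace, h, ricciOf]
    ring

lemma weyl_add_ricciPart (R : Fin 4 → Fin 4 → Fin 4 → Fin 4 → ℝ) :
    weyl R + ricciPart (ricci R) = lower R := by
  funext a b c d
  exact sub_add_cancel _ _

lemma ricci_raise_weyl (hR : ∀ a b, ricci R a b = ricci R b a) : ricci (raise (weyl R)) = 0 := by
  have h := ricci_raise_add (weyl R) (ricciPart (ricci R))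
  rwa [weyl_add_ricciPart, raise_lower, ricci_raise_ricciPart hR, right_eq_add] at h

lemma lower_riemannOf (E H T : Fin 4 → Fin 4 → ℝ) :
    lower (riemannOf E H T) = weylOf E H + ricciPart (ricciOf T) :=
  lower_raise _

lemma isBivectorForm_riemannOf (hE : ∀ a b, E a b = E b a) (hT : ∀ a b, T a b = T b a) :
    IsBivectorForm (lower (riemannOf E H T)) := by
  rw [lower_riemannOf]
  exact (isBivectorForm_weylOf hE).add (isBivectorForm_ricciPart (ricciOf_symm hT))

lemma ricci_riemannOf (hE : IsSpatial E) (hH : IsSpatial H) (htr : trace2 E = 0)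
    (hT : ∀ a b, T a b = T b a) : ricci (riemannOf E H T) = ricciOf T := by
  rw [← raise_lower (riemannOf E H T), lower_riemannOf, ricci_raise_add,
    ricci_raise_weylOf hE hH htr, ricci_raise_ricciPart (ricciOf_symm hT), zero_add]

lemma weyl_riemannOf (hE : IsSpatial E) (hH : IsSpatial H) (htr : trace2 E = 0)
    (hT : ∀ a b, T a b = T b a) : weyl (riemannOf E H T) = weylOf E H := by
  have h := weyl_add_ricciPart (riemannOf E H T)
  rwa [ricci_riemannOf hE hH htr hT, lower_riemannOf, add_left_inj] at h

lemma riemannOf_electric_magnetic (hR : IsBivectorForm (lower R)) (hT : ∀ a b, T a b = T b a)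
    (hricci : ricci R = ricciOf T) :
    riemannOf (electric (weyl R)) (magnetic (weyl R)) T = R := by
  have hsymm (a b : Fin 4) : ricci R a b = ricci R b a := hricci ▸ ricciOf_symm hT a b
  have hweyl : IsBivectorForm (weyl R) := hR.sub (isBivectorForm_ricciPart hsymm)
  rw [← raise_lower (riemannOf _ _ T), lower_riemannOf, ← hweyl.eq_weylOf (ricci_raise_weyl hsymm),
    ← hricci, weyl_add_ricciPart, raise_lower]

lemma riemannOf_eq_iff (hE : IsSpatial E) (hH : IsSpatial H) (htr : trace2 E = 0)
    (hT : ∀ a b, T a b = T b a) (hR : IsBivectorForm (lower R)) :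
    riemannOf E H T = R
      ↔ EinsteinEq R T ∧ E = electric (weyl R) ∧ H = magnetic (weyl R) := by
  rw [einsteinEq_iff]
  constructor
  · rintro rfl
    rw [weyl_riemannOf hE hH htr hT, electric_weylOf hE, magnetic_weylOf hE hH]
    exact ⟨ricci_riemannOf hE hH htr hT, rfl, rfl⟩
  · rintro ⟨hricci, rfl, rfl⟩
    exact riemannOf_electric_magnetic hR hT hricci

end Einstein

section Kernel

variable {n 𝕜 : Type*} [Field 𝕜] {v : n → 𝕜} {P : Matrix n n 𝕜}

lemma exists_eq_smul_vecMulVec (hv : v ≠ 0) (hP : P.IsSymm)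
    (hcross : ∀ i j k, v i * P j k = v j * P i k) : ∃ c : 𝕜, P = c • Matrix.vecMulVec v v := by
  obtain ⟨i, hi⟩ := Function.ne_iff.1 hv
  rw [Pi.zero_apply] at hi
  refine ⟨P i i / (v i * v i), Matrix.ext fun j k => ?_⟩
  rw [Matrix.smul_apply, Matrix.vecMulVec_apply, smul_eq_mul, div_mul_eq_mul_div,
    eq_div_iff (mul_ne_zero hi hi)]
  linear_combination v i * hcross i j k - v i * v j * hP.apply i k - v j * hcross k i i

lemma eq_zero_of_isSymm_mul_of_not_eigenvector [Fintype n] {A : Matrix n n 𝕜} (hv : v ≠ 0)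
    (hP : P.IsSymm) (hcross : ∀ i j k, v i * P j k = v j * P i k) (hAP : (A * P).IsSymm)
    (hA : ∀ μ : 𝕜, A.mulVec v ≠ μ • v) : P = 0 := by
  obtain ⟨c, rfl⟩ := exists_eq_smul_vecMulVec hv hP hcross
  obtain ⟨i, hi⟩ := Function.ne_iff.1 hv
  rw [Pi.zero_apply] at hi
  by_contra hne
  have hc : c ≠ 0 := fun hc => hne (by rw [hc, zero_smul])
  refine hA (A.mulVec v i / v i) (funext fun j => ?_)
  have hij := hAP.apply j i
  simp only [Matrix.mul_smul, Matrix.mul_vecMulVec, Matrix.smul_apply, Matrix.vecMulVec_apply,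
    smul_eq_mul] at hij
  rw [Pi.smul_apply, smul_eq_mul, div_mul_eq_mul_div, eq_div_iff hi]
  exact (mul_left_cancel₀ hc hij).symm

end Kernel

namespace IsBivectorForm

variable {L : Fin 4 → Fin 4 → Fin 4 → Fin 4 → ℝ} {K : Matrix (Fin 4) (Fin 4) ℝ}

lemma eq_zero_of_spatialPart_eq_zero (hL : IsBivectorForm L) (htime : ∀ a c d, L a 0 c d = 0)
    (hspatial : spatialPart L = 0) : L = 0 := by
  refine hL.ext ⟨fun _ _ _ _ => neg_zero.symm, fun _ _ _ _ => neg_zero.symm, fun _ _ _ _ => rfl⟩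
    ?_ ?_ hspatial
  · funext a b
    rw [electric_eq, electric_eq, htime]
    rfl
  · simp [funext_iff, magnetic_eq, hL.symm_pair _ _ _ 0, htime]

lemma sum_mul_apply_succ (hL : IsBivectorForm L) (htime : ∀ a c d, L a 0 c d = 0)
    (k : Fin 4) (i j : Fin 3) :
    ∑ f, K f k * L i.succ f (j + 1).succ (j + 2).succ
      = K (i + 1).succ k * spatialPart L (i + 2) j
        - K (i + 2).succ k * spatialPart L (i + 1) j := by
  rw [Fin.sum_univ_succ, htime, sum_univ_three_cyclic _ i, hL.apply_self_left,
    hL.antisymm_left i.succ (i + 2).succ]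
  simp only [spatialPart, add_assoc, Fin.reduceAdd, add_zero]
  ring

lemma mul_spatialPart_comm (hL : IsBivectorForm L) (htime : ∀ a c d, L a 0 c d = 0)
    (hcyclic : ∀ a c d k, ∑ f, K f k * L a f c d + ∑ f, K f c * L a f d k
      + ∑ f, K f d * L a f k c = 0)
    (i j k : Fin 3) :
    K i.succ 0 * spatialPart L j k = K j.succ 0 * spatialPart L i k := by
  refine rel_of_rel_add_one_add_two
    (r := fun i j => K i.succ 0 * spatialPart L j k = K j.succ 0 * spatialPart L i k)
    (fun _ => rfl) (fun _ _ => Eq.symm) (fun i => ?_) i j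
  have hzero (a b c : Fin 4) : L a b c 0 = 0 := by rw [hL.symm_pair, htime]
  have h := hcyclic i.succ (k + 1).succ (k + 2).succ 0
  simp only [hL.antisymm_right _ _ 0, hzero, neg_zero, mul_zero, Finset.sum_const_zero,
    add_zero, hL.sum_mul_apply_succ htime] at h
  exact sub_eq_zero.1 h

lemma isSymm_mul_spatialPart (hL : IsBivectorForm L) (htime : ∀ a c d, L a 0 c d = 0)
    (hcyclic : ∀ a c d k, ∑ f, K f k * L a f c d + ∑ f, K f c * L a f d k
      + ∑ f, K f d * L a f k c = 0) :
    (K.submatrix Fin.succ Fin.succ * Matrix.of (spatialPart L)).IsSymm := by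
  have hprod (i j : Fin 3) : (K.submatrix Fin.succ Fin.succ * Matrix.of (spatialPart L)) i j
      = ∑ k : Fin 3, K i.succ k.succ * spatialPart L j k := by
    rw [Matrix.mul_apply]
    exact Finset.sum_congr rfl fun k _ => congrArg (K i.succ k.succ * ·) (hL.symm_pair _ _ _ _)
  refine Matrix.IsSymm.ext fun i j => ?_
  rw [hprod, hprod]
  refine rel_of_rel_add_one_add_two
    (r := fun i j => ∑ k : Fin 3, K j.succ k.succ * spatialPart L i k
      = ∑ k : Fin 3, K i.succ k.succ * spatialPart L j k)
    (fun _ => rfl) (fun _ _ => Eq.symm) (fun i => ?_) i j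
  have h : ∑ j : Fin 3, ∑ f, K f j.succ * L i.succ f (j + 1).succ (j + 2).succ = 0 := by
    rw [Fin.sum_univ_three, ← hcyclic i.succ 1 2 3, add_comm, ← add_assoc]
    rfl
  simp only [hL.sum_mul_apply_succ htime, Finset.sum_sub_distrib] at h
  exact (sub_eq_zero.1 h).symm

lemma eq_zero_of_cyclic_sum (hL : IsBivectorForm L) (htime : ∀ a c d, L a 0 c d = 0)
    (hcyclic : ∀ a c d k, ∑ f, K f k * L a f c d + ∑ f, K f c * L a f d k
      + ∑ f, K f d * L a f k c = 0)
    (hv : (fun i : Fin 3 => K i.succ 0) ≠ 0)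
    (hK : ∀ μ : ℝ, (K.submatrix Fin.succ Fin.succ).mulVec (fun i => K i.succ 0)
      ≠ μ • fun i => K i.succ 0) : L = 0 :=
  hL.eq_zero_of_spatialPart_eq_zero htime <| eq_zero_of_isSymm_mul_of_not_eigenvector
    (P := Matrix.of (spatialPart L)) hv (Matrix.IsSymm.ext fun _ _ => hL.symm_pair _ _ _ _)
    (hL.mul_spatialPart_comm htime hcyclic) (hL.isSymm_mul_spatialPart htime hcyclic) hK

end IsBivectorForm

section Generic

variable {M : Type*} [TopologicalSpace M] [ChartedSpace (EuclideanSpace ℝ (Fin 4)) M]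
  {e : Fin 4 → ∀ x : M, TangentSpace (𝓡 4) x} {γ : M → Fin 4 → Fin 4 → Fin 4 → ℝ} {x : M}

lemma hMix_zero_left (a : Fin 4) : hMix 0 a = 0 := by
  simp [hMix, hLow_comm 0, hLow_zero]

lemma hMix_succ_left (i : Fin 3) (a : Fin 4) : hMix i.succ a = if a = i.succ then 1 else 0 := by
  rw [hMix, sum_eta_mul]
  cases a using Fin.cases with
  | zero => rw [hLow_zero, mul_zero, if_neg (Fin.succ_ne_zero i).symm]
  | succ j => simp [eta_succ_succ, hLow_succ_succ, eq_comm (a := i)]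

lemma projGrad_zero_left (b : Fin 4) : projGrad e γ x 0 b = 0 := by
  simp [projGrad, hMix_zero_left]

lemma projGrad_succ_succ (i j : Fin 3) :
    projGrad e γ x i.succ j.succ = gradU e γ x i.succ j.succ := by
  simp [projGrad, hMix_succ_left, sum_eta_mul, eta_succ_succ]

lemma shearVorticity_eq (a b : Fin 4) : shearVorticity e γ x a b
    = eta a a * (projGrad e γ x a b - 1 / 3 * expansion e γ x * hLow a b) := by
  rw [shearVorticity, Matrix.of_apply, sum_eta_mul, shear, vorticity]
  ring

lemma shearVorticity_zero_left (b : Fin 4) : shearVorticity e γ x 0 b = 0 := by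
  rw [shearVorticity_eq, projGrad_zero_left, hLow_comm, hLow_zero, mul_zero, sub_zero, mul_zero]

lemma shearVorticity_succ_succ (i j : Fin 3) : shearVorticity e γ x i.succ j.succ
    = gradU e γ x i.succ j.succ - if i = j then 1 / 3 * expansion e γ x else 0 := by
  simp [shearVorticity_eq, projGrad_succ_succ, hLow_succ_succ, eta_succ_succ]

lemma accel_eq (a : Fin 4) : accel e γ x a = gradU e γ x a 0 := by
  simp [accel, uUp]

lemma accel_ne_zero_iff (hnorm : ∀ b, gradU e γ x 0 b = 0) :
    accel e γ x ≠ 0 ↔ (fun i : Fin 3 => gradU e γ x i.succ 0) ≠ 0 := by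
  simp [Function.ne_iff, accel_eq, Fin.exists_fin_succ, hnorm]

lemma Generic.mulVec_gradU_ne (hgen : Generic e γ x) (hnorm : ∀ b, gradU e γ x 0 b = 0) (μ : ℝ) :
    ((Matrix.of (gradU e γ x)).submatrix Fin.succ Fin.succ).mulVec
      (fun i => gradU e γ x i.succ 0) ≠ μ • fun i => gradU e γ x i.succ 0 := by
  intro hμ
  refine hgen.2 ⟨μ - 1 / 3 * expansion e γ x, Module.End.mem_eigenspace_iff.2 ?_, hgen.1⟩
  funext a
  rw [Matrix.toLin'_apply, Matrix.mulVec, dotProduct, Fin.sum_univ_succ, accel_eq, hnorm, mul_zero,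
    zero_add, Pi.smul_apply, accel_eq, smul_eq_mul]
  cases a using Fin.cases with
  | zero => simp [shearVorticity_zero_left, hnorm]
  | succ i =>
    have hi := congrFun hμ i
    simp only [Matrix.mulVec, dotProduct, Matrix.submatrix_apply, Matrix.of_apply, Pi.smul_apply,
      smul_eq_mul] at hi
    simp [shearVorticity_succ_succ, accel_eq, sub_mul, hi]

end Generic

section Uniqueness

variable {M : Type*} [TopologicalSpace M] [ChartedSpace (EuclideanSpace ℝ (Fin 4)) M]
  {e : Fin 4 → ∀ x : M, TangentSpace (𝓡 4) x} {γ : M → Fin 4 → Fin 4 → Fin 4 → ℝ} {x : M}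
  {D R S : M → Fin 4 → Fin 4 → Fin 4 → Fin 4 → ℝ}

lemma alt3_eq_of_antisymm {F : Fin 4 → Fin 4 → Fin 4 → ℝ} (hF : ∀ a b c, F a b c = -F b a c)
    (a b c : Fin 4) : alt3 F a b c = 1 / 3 * (F a b c + F b c a + F c a b) := by
  rw [alt3, hF b a c, hF a c b, hF c b a]
  ring

lemma covD13_apply_zero {a c d k : Fin 4} (htime : ∀ a c d, D x a 0 c d = 0)
    (hderiv : dirD e k (fun y => D y a 0 c d) x = 0) :
    covD13 e γ D x a 0 c d k = -∑ f, gradU e γ x f k * D x a f c d := by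
  simp only [covD13, hderiv, htime, gradU_eq, mul_zero, zero_add, sub_zero, zero_sub,
    Finset.sum_neg_distrib]

lemma bianchiRes_apply_zero {a : Fin 4} (htime : ∀ a c d, D x a 0 c d = 0)
    (hderiv : ∀ k c d, dirD e k (fun y => D y a 0 c d) x = 0)
    (hD : ∀ f c d, D x a f c d = -D x a f d c) (c d k : Fin 4) :
    bianchiRes e γ D a 0 c d k x
      = -(1 / 3) * (∑ f, gradU e γ x f k * D x a f c d + ∑ f, gradU e γ x f c * D x a f d k
        + ∑ f, gradU e γ x f d * D x a f k c) := by
  simp only [bianchiRes, covD13_apply_zero htime (hderiv _ _ _)]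
  rw [alt3_eq_of_antisymm fun c d k => by
    simp only [fun f => hD f c d, mul_neg, Finset.sum_neg_distrib]]
  ring

lemma eq_zero_of_bianchiRes (hgen : Generic e γ x) (hnorm : ∀ b, gradU e γ x 0 b = 0)
    (hD : IsBivectorForm (lower (D x))) (htime : ∀ a c d, D x a 0 c d = 0)
    (hderiv : ∀ k a c d, dirD e k (fun y => D y a 0 c d) x = 0)
    (hbianchi : ∀ a c d k, bianchiRes e γ D a 0 c d k x = 0) : D x = 0 := by
  have hanti (a f c d : Fin 4) : D x a f c d = -D x a f d c := by
    have h := congrArg (eta a a * ·) (hD.antisymm_right a f c d)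
    simpa only [lower_eq, mul_neg, ← mul_assoc, eta_mul_self, one_mul] using h
  have hzero : lower (D x) = 0 := by
    refine hD.eq_zero_of_cyclic_sum (K := Matrix.of (gradU e γ x)) (fun a c d => ?_)
      (fun a c d k => ?_) ((accel_ne_zero_iff hnorm).1 hgen.1) (hgen.mulVec_gradU_ne hnorm)
    · rw [lower_eq, htime, mul_zero]
    · have h := bianchiRes_apply_zero (γ := γ) htime (hderiv · a) (hanti a) c d k
      rw [hbianchi, zero_eq_mul, or_iff_right (by norm_num)] at h
      simp only [lower_eq, Matrix.of_apply, mul_left_comm _ (eta a a), ← Finset.mul_sum, ← mul_add,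
        h, mul_zero]
  rw [← raise_lower (D x), hzero]
  funext a b c d
  simp [raise]

variable {U : Set M}

lemma bianchiRes_sub
    (hR : ∀ a b c d k, HasDirD e k (fun y => R y a b c d) (dirD e k (fun y => R y a b c d) x) x)
    (hS : ∀ a b c d k, HasDirD e k (fun y => S y a b c d) (dirD e k (fun y => S y a b c d) x) x)
    (a b c d k : Fin 4) :
    bianchiRes e γ (R - S) a b c d k x
      = bianchiRes e γ R a b c d k x - bianchiRes e γ S a b c d k x := by
  have hcov (c d k : Fin 4) :
      covD13 e γ (R - S) x a b c d k = covD13 e γ R x a b c d k - covD13 e γ S x a b c d k := by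
    have h := ((hR a b c d k).sub (hS a b c d k)).2
    simp only [covD13, Pi.sub_apply, h, mul_sub, Finset.sum_sub_distrib]
    ring
  simp only [bianchiRes, alt3, hcov]
  ring

namespace IsTetrad

variable [IsManifold (𝓡 4) ∞ M] {g : ∀ x : M, LinearMap.BilinForm ℝ (TangentSpace (𝓡 4) x)}

lemma gradU_zero_left (he : IsTetrad U g e γ) (hx : x ∈ U) (b : Fin 4) : gradU e γ x 0 b = 0 := by
  have h := he.eta_mul_conn hx 0 0 b
  rw [eta_zero_zero] at h
  rw [gradU_eq]
  linarith

lemma ricciRes_eq_curv_sub (he : IsTetrad U g e γ) (hx : x ∈ U) (a c d : Fin 4) :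
    ricciRes e γ R a c d x = curv e γ x a 0 d c - R x a 0 d c := by
  have h := he.ricciRes_curv hx a c d
  rw [ricciRes_eq, sub_eq_zero] at h
  rw [ricciRes_eq, h]

lemma isBivectorForm_curv (he : IsTetrad U g e γ) (hU : IsOpen U) (hx : x ∈ U) :
    IsBivectorForm (lower (curv e γ x)) :=
  have h := he.isCurvatureLike_curv hU
  ⟨h.antisymm_left x hx, h.antisymm_right x hx, h.symm_pair x hx⟩

lemma eq_curv (he : IsTetrad U g e γ) (hU : IsOpen U) (hx : x ∈ U) (hgen : Generic e γ x)
    (hsmooth : ∀ a b c d, ContMDiffOn (𝓡 4) 𝓘(ℝ, ℝ) ∞ (fun y => R y a b c d) U)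
    (hR : IsBivectorForm (lower (R x))) (hricci : ∀ a c d, ricciRes e γ R a c d x = 0)
    (hderiv : ∀ k a c d, dirD e k (ricciRes e γ R a c d) x = 0)
    (hbianchi : ∀ a b c d k, bianchiRes e γ R a b c d k x = 0) : R x = curv e γ x := by
  have hcurv := he.isCurvatureLike_curv hU
  have hdR (a b c d k : Fin 4) := hasDirD_of_contMDiffOn (e := e) (a := k) hU hx (hsmooth a b c d)
  have hdcurv (a b c d k : Fin 4) :=
    hasDirD_of_contMDiffOn (e := e) (a := k) hU hx (hcurv.smooth a b c d)
  have hlower : lower ((curv e γ - R) x)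
      = fun a b c d => lower (curv e γ x) a b c d - lower (R x) a b c d := by
    funext a b c d
    simp only [lower_eq, Pi.sub_apply, mul_sub]
  have hzero : (curv e γ - R) x = 0 := by
    refine eq_zero_of_bianchiRes hgen (he.gradU_zero_left hx) ?_ (fun a c d => ?_)
      (fun k a c d => ?_) fun a c d k => ?_
    · rw [hlower]
      exact (he.isBivectorForm_curv hU hx).sub hR
    · exact (he.ricciRes_eq_curv_sub hx a d c).symm.trans (hricci a d c)
    · rw [← hderiv k a d c]
      exact dirD_congr_of_eqOn hU hx fun y hy => (he.ricciRes_eq_curv_sub hy a d c).symm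
    · rw [bianchiRes_sub hdcurv hdR, hcurv.bianchi_second x hx, hbianchi, sub_zero]
  exact (sub_eq_zero.1 hzero).symm

lemma eq_curv_of_ricciRes_eq_zero (he : IsTetrad U g e γ) (hU : IsOpen U) (hx : x ∈ U)
    (hgen : Generic e γ x)
    (hsmooth : ∀ a b c d, ContMDiffOn (𝓡 4) 𝓘(ℝ, ℝ) ∞ (fun y => R y a b c d) U)
    (hR : IsBivectorForm (lower (R x))) (hricci : ∀ y ∈ U, ∀ a c d, ricciRes e γ R a c d y = 0)
    (hbianchi : ∀ a b c d k, bianchiRes e γ R a b c d k x = 0) : R x = curv e γ x :=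
  he.eq_curv hU hx hgen hsmooth hR (hricci x hx) (fun _ a c d =>
    (dirD_congr_of_eqOn hU hx fun y hy => hricci y hy a c d).trans (hasDirD_const 0).2) hbianchi

end IsTetrad
end Uniqueness

section System

variable {M : Type*} [TopologicalSpace M] [ChartedSpace (EuclideanSpace ℝ (Fin 4)) M]
  {U : Set M} {x : M} {e : Fin 4 → ∀ x : M, TangentSpace (𝓡 4) x}
  {γ : M → Fin 4 → Fin 4 → Fin 4 → ℝ} {R S : M → Fin 4 → Fin 4 → Fin 4 → Fin 4 → ℝ}

lemma SystemAt.congr (hR : SystemAt e γ R x) (hU : IsOpen U) (hx : x ∈ U)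
    (hRS : ∀ y ∈ U, R y = S y) : SystemAt e γ S x where
  jacobi := hR.jacobi
  ricci a c d := by rw [← hR.ricci a c d, ricciRes_eq, ricciRes_eq, hRS x hx]
  bianchi a b c d k := by
    have hderiv (a b c d k : Fin 4) :
        dirD e k (fun y => S y a b c d) x = dirD e k (fun y => R y a b c d) x :=
      dirD_congr_of_eqOn hU hx fun y hy => by rw [hRS y hy]
    rw [← hR.bianchi a b c d k]
    simp only [bianchiRes, covD13, hderiv, hRS x hx]

namespace IsExtendedVars

variable {E H T : M → Fin 4 → Fin 4 → ℝ}

lemma isSpatial_E (h : IsExtendedVars U E H T) (hx : x ∈ U) : IsSpatial (E x) :=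
  ⟨h.symm_E x hx, fun a => by simpa [uUp] using h.orth_E x hx a⟩

lemma isSpatial_H (h : IsExtendedVars U E H T) (hx : x ∈ U) : IsSpatial (H x) :=
  ⟨h.symm_H x hx, fun a => by simpa [uUp] using h.orth_H x hx a⟩

lemma isBivectorForm_riemannOf (h : IsExtendedVars U E H T) (hx : x ∈ U) :
    IsBivectorForm (lower (riemannOf (E x) (H x) (T x))) :=
  JRB.isBivectorForm_riemannOf (h.symm_E x hx) (h.symm_T x hx)

lemma riemannOf_eq_iff (h : IsExtendedVars U E H T) (hx : x ∈ U)
    (hR : IsBivectorForm (lower (R x))) :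
    riemannOf (E x) (H x) (T x) = R x
      ↔ EinsteinEq (R x) (T x) ∧ E x = electric (weyl (R x)) ∧ H x = magnetic (weyl (R x)) :=
  JRB.riemannOf_eq_iff (h.isSpatial_E hx) (h.isSpatial_H hx) (h.trace_E x hx) (h.symm_T x hx) hR

lemma contMDiffOn_riemannOf (h : IsExtendedVars U E H T) (a b c d : Fin 4) :
    ContMDiffOn (𝓡 4) 𝓘(ℝ, ℝ) ∞ (fun y => riemannOf (E y) (H y) (T y) a b c d) U := by
  simp only [riemannOf, raise, weylOf, ricciPart, ricciOf, trace2]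
  repeat' first
    | exact contMDiffOn_const
    | exact h.smooth_E _ _
    | exact h.smooth_H _ _
    | exact h.smooth_T _ _
    | refine contMDiffOn_finsetSum fun _ _ => ?_
    | refine ContMDiffOn.sub ?_ ?_
    | refine ContMDiffOn.add ?_ ?_
    | refine ContMDiffOn.mul ?_ ?_

end IsExtendedVars

namespace IsTetrad

variable [IsManifold (𝓡 4) ∞ M] {g : ∀ x : M, LinearMap.BilinForm ℝ (TangentSpace (𝓡 4) x)}

lemma systemAt_curv (he : IsTetrad U g e γ) (hU : IsOpen U) (hx : x ∈ U) :
    SystemAt e γ (curv e γ) x where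
  jacobi := he.jacobiRes_eq_zero hU hx
  ricci := he.ricciRes_curv hx
  bianchi := (he.isCurvatureLike_curv hU).bianchi_second x hx

lemma forall_systemAt_iff (he : IsTetrad U g e γ) (hU : IsOpen U)
    (hgen : ∀ x ∈ U, Generic e γ x)
    (hsmooth : ∀ a b c d, ContMDiffOn (𝓡 4) 𝓘(ℝ, ℝ) ∞ (fun y => R y a b c d) U)
    (hR : ∀ x ∈ U, IsBivectorForm (lower (R x))) :
    (∀ x ∈ U, SystemAt e γ R x) ↔ ∀ x ∈ U, R x = curv e γ x :=
  ⟨fun h x hx => he.eq_curv_of_ricciRes_eq_zero hU hx (hgen x hx) hsmooth (hR x hx)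
    (fun y hy => (h y hy).ricci) (h x hx).bianchi,
  fun h _ hx => (he.systemAt_curv hU hx).congr hU hx fun y hy => (h y hy).symm⟩

end IsTetrad
end System

end JRB

theorem theorem1 {M : Type*} [TopologicalSpace M] [ChartedSpace (EuclideanSpace ℝ (Fin 4)) M]
    [IsManifold (𝓡 4) ∞ M] (U : Set M) (hU : IsOpen U)
    (g : ∀ x : M, LinearMap.BilinForm ℝ (TangentSpace (𝓡 4) x))
    (e : Fin 4 → ∀ x : M, TangentSpace (𝓡 4) x)
    (γ : M → Fin 4 → Fin 4 → Fin 4 → ℝ)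
    (he : JRB.IsTetrad U g e γ)
    (hgen : ∀ x ∈ U, JRB.Generic e γ x) :
    -- every solution of the system on `U` satisfies the field equations; more precisely, the
    -- solutions are the solutions of the field equations in which `E` and `H` are the parts of
    -- the Weyl tensor
    (∀ E H T : M → Fin 4 → Fin 4 → ℝ, JRB.IsExtendedVars U E H T →
      ((∀ x ∈ U, JRB.SystemAt e γ (fun y => JRB.riemannOf (E y) (H y) (T y)) x) ↔
        ∀ x ∈ U, JRB.EinsteinEq (JRB.curv e γ x) (T x) ∧
          E x = JRB.electric (JRB.weyl (JRB.curv e γ x)) ∧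
          H x = JRB.magnetic (JRB.weyl (JRB.curv e γ x)))) ∧
    -- the field equations at a point are consequences of the system and of its first derivatives
    -- at that point
    (∀ E H T : M → Fin 4 → Fin 4 → ℝ, JRB.IsExtendedVars U E H T → ∀ x ∈ U,
      JRB.ProlongedSystemAt e γ (fun y => JRB.riemannOf (E y) (H y) (T y)) x →
        JRB.EinsteinEq (JRB.curv e γ x) (T x)) ∧
    -- the curvature tensor is the unique tensor with the stated properties
    (JRB.IsCurvatureLike U e γ (JRB.curv e γ) ∧
      ∀ R : M → Fin 4 → Fin 4 → Fin 4 → Fin 4 → ℝ, JRB.IsCurvatureLike U e γ R →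
        ∀ x ∈ U, R x = JRB.curv e γ x) := by
  refine ⟨fun E H T h => ?_, fun E H T h x hx hsys => ?_, he.isCurvatureLike_curv hU,
    fun R hR x hx => ?_⟩
  · rw [he.forall_systemAt_iff hU hgen h.contMDiffOn_riemannOf fun _ => h.isBivectorForm_riemannOf]
    exact forall₂_congr fun x hx => h.riemannOf_eq_iff hx (he.isBivectorForm_curv hU hx)
  · have heq := he.eq_curv hU hx (hgen x hx) h.contMDiffOn_riemannOf
      (h.isBivectorForm_riemannOf hx) hsys.ricci hsys.deriv_ricci hsys.bianchi
    exact ((h.riemannOf_eq_iff hx (he.isBivectorForm_curv hU hx)).1 heq).1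
  · exact he.eq_curv_of_ricciRes_eq_zero hU hx (hgen x hx) hR.smooth
      ⟨hR.antisymm_left x hx, hR.antisymm_right x hx, hR.symm_pair x hx⟩ hR.ricci
      (hR.bianchi_second x hx)
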